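/- Let $\varphi$ be the Thue--Morse morphism $0\mapsto 01$, $1\mapsto 10$ on binary words (finite or infinite), and let $\mathbf{t}=01101001\cdots$ be the Thue--Morse word, the fixed point of $\varphi$ that starts with $0$. For finite words $u,w$, let $\binom{u}{w}$ be the number of times $w$ occurs as a (scattered) subword of $u$, that is, the number of increasing sequences of $|w|$ positions of $u$ at which one reads $w$. For $j\ge 1$, two finite words $u,v$ are $j$-binomially equivalent, $u\sim_j v$, if $\binom{u}{w}=\binom{v}{w}$ for all words $w$ of length at most $j$. The $j$-binomial complexity $\mathsf{b}^{(j)}_{\mathbf{x}}\colon\mathbb{N}\to\mathbb{N}$ of an infinite word $\mathbf{x}$ maps $n$ to the number of $\sim_j$-classes of factors (contiguous subwords) of length $n$ of $\mathbf{x}$. An infinite word is recurrent if each of its factors occurs in it infinitely often. Theorem. Let $k\ge 1$ and let $\mathbf{x}\in\{0,1\}^{\mathbb{N}}$ be a recurrent binary word such that $\mathsf{b}^{(j)}_{\mathbf{x}}=\mathsf{b}^{(j)}_{\mathbf{t}}$ for all $1\le j\le k$. Then there exist an infinite binary word $\mathbf{y}\in\{0,1\}^{\mathbb{N}}$ and a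 (possibly empty) proper suffix $u$ of $\varphi^k(0)$ or of $\varphi^k(1)$ such that $\mathbf{x}=u\varphi^k(\mathbf{y})$. -/

import Mathlib

namespace BinomialWords

/-- The binomial coefficient of the words `u` and `w`: the number of increasing sequences of
positions of `u` (indexed by the positions of `w`) at which one reads `w`. -/
noncomputable def binom {α : Type*} (u w : List α) : ℕ :=
  Nat.card {i : Fin w.length → Fin u.length // StrictMono i ∧ ∀ j, u.get (i j) = w.get j}

/-- The `k`-binomial equivalence of finite words. -/
def binomSetoid (α : Type*) (k : ℕ) : Setoid (List α) where
  r u v := ∀ w : List α, w.length ≤ k → binom u w = binom v w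
  iseqv :=
    { refl := fun _ _ _ => rfl
      symm := fun h w hw => (h w hw).symm
      trans := fun h h' w hw => (h w hw).trans (h' w hw) }

/-- The word of length `n` that occurs in the infinite word `x` at position `i`. -/
def block {α : Type*} (x : ℕ → α) (i n : ℕ) : List α :=
  List.ofFn fun j : Fin n => x (i + j)

/-- The set of factors of length `n` of the infinite word `x`. -/
def factors {α : Type*} (x : ℕ → α) (n : ℕ) : Set (List α) :=
  Set.range fun i => block x i n

/-- The `k`-binomial complexity function of `x`: the number of `k`-binomial equivalence classes
of factors of length `n` (there are finitely many factors of length `n` over a finite alphabet). -/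
noncomputable def binomComplexity {α : Type*} (k : ℕ) (x : ℕ → α) (n : ℕ) : ℕ :=
  ((fun w => (Quotient.mk (binomSetoid α k) w)) '' factors x n).ncard

/-- An infinite word is recurrent if each of its factors occurs infinitely often. -/
def Recurrent {α : Type*} (x : ℕ → α) : Prop :=
  ∀ n, ∀ w ∈ factors x n, {i | block x i n = w}.Infinite

/-- The concatenation of the finite word `u` and the infinite word `x`. -/
def concat {α : Type*} (u : List α) (x : ℕ → α) : ℕ → α :=
  fun n => if h : n < u.length then u[n] else x (n - u.length)

/-- The images of the letters under the Thue–Morse morphism `0 ↦ 01`, `1 ↦ 10`. -/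
def tmLetter : Fin 2 → List (Fin 2)
  | 0 => [0, 1]
  | 1 => [1, 0]

/-- The Thue–Morse morphism on finite words. -/
def tm (u : List (Fin 2)) : List (Fin 2) :=
  u.flatMap tmLetter

/-- The Thue–Morse morphism on infinite words: `φ(y) = φ(y₀)φ(y₁)φ(y₂)⋯`, where each `φ(yᵢ)` has
length two. -/
def tmInf (y : ℕ → Fin 2) : ℕ → Fin 2 :=
  fun n => (tmLetter (y (n / 2))).getD (n % 2) 0

/-- The Thue–Morse word, the limit of the words `φⁿ(0)`: its letter at position `n` is the letter
at position `n` of `φⁿ(0)`, a word of length `2ⁿ`. -/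
def thueMorse : ℕ → Fin 2 :=
  fun n => (tm^[n] [0]).getD n 0

/-- A binary word has property `P(k)` if it has the same `j`-binomial complexity as the
Thue–Morse word for all `1 ≤ j ≤ k`. -/
def TMProp (k : ℕ) (x : ℕ → Fin 2) : Prop :=
  ∀ j, 1 ≤ j → j ≤ k → binomComplexity j x = binomComplexity j thueMorse

theorem tm_cons (a : Fin 2) (u : List (Fin 2)) : tm (a :: u) = tmLetter a ++ tm u := by
  simp [tm]

theorem length_tmLetter (a : Fin 2) : (tmLetter a).length = 2 := by
  fin_cases a <;> rfl

theorem length_tm (u : List (Fin 2)) : (tm u).length = 2 * u.length := by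
  induction u with
  | nil => rfl
  | cons a u ih => rw [tm_cons, List.length_append, ih, length_tmLetter, List.length_cons]; ring

theorem getD_tm (u : List (Fin 2)) (n : ℕ) (hn : n < 2 * u.length) :
    (tm u).getD n 0 = (tmLetter (u.getD (n / 2) 0)).getD (n % 2) 0 := by
  induction u generalizing n with
  | nil => simp at hn
  | cons a u ih =>
    rw [tm_cons]
    by_cases h : n < 2
    · rw [List.getD_append _ _ _ _ (by rw [length_tmLetter]; exact h), Nat.div_eq_of_lt h,
        Nat.mod_eq_of_lt h]
      rfl
    · obtain ⟨m, rfl⟩ : ∃ m, n = m + 2 := ⟨n - 2, by omega⟩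
      rw [List.getD_append_right _ _ _ _ (by rw [length_tmLetter]; omega), length_tmLetter,
        Nat.add_sub_cancel, ih m (by simp at hn; omega)]
      simp

/-- The image of an infinite word has the images of its prefixes as prefixes. -/
theorem block_tmInf (y : ℕ → Fin 2) (n : ℕ) : block (tmInf y) 0 (2 * n) = tm (block y 0 n) := by
  apply List.ext_getElem
  · simp [block, length_tm]
  · intro i h₁ h₂
    have hi : i < 2 * n := by simpa [block] using h₁
    have h := getD_tm (block y 0 n) i (by simpa [block] using hi)
    rw [List.getD_eq_getElem _ _ h₂] at h
    have hb : i / 2 < (block y 0 n).length := by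
      simp only [block, List.length_ofFn]
      omega
    rw [h, List.getD_eq_getElem _ _ hb]
    simp [block, tmInf]

theorem length_tm_iterate (m : ℕ) : (tm^[m] [0]).length = 2 ^ m := by
  induction m with
  | zero => rfl
  | succ m ih => rw [Function.iterate_succ_apply', length_tm, ih, pow_succ]; ring

/-- All the words `φᵐ(0)` are prefixes of the Thue–Morse word. -/
theorem getD_tm_iterate (m n : ℕ) (h : n < 2 ^ m) : (tm^[m] [0]).getD n 0 = thueMorse n := by
  induction n using Nat.strong_induction_on generalizing m with
  | _ n ih =>
    have key : ∀ p, n < 2 ^ (p + 1) → (tm^[p + 1] [0]).getD n 0 =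
        (tmLetter ((tm^[p] [0]).getD (n / 2) 0)).getD (n % 2) 0 := by
      intro p hp
      rw [Function.iterate_succ_apply', getD_tm _ _ (by rw [length_tm_iterate]; omega)]
    rcases Nat.eq_zero_or_pos n with rfl | hn
    · clear ih key
      induction m with
      | zero => rfl
      | succ m ihm =>
        rw [Function.iterate_succ_apply', getD_tm _ _ (by rw [length_tm_iterate]; positivity),
          Nat.zero_div, ihm (by positivity)]
        rfl
    · obtain ⟨q, rfl⟩ : ∃ q, n = q + 1 := ⟨n - 1, by omega⟩
      obtain ⟨p, rfl⟩ : ∃ p, m = p + 1 := by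
        cases m with
        | zero => simp at h
        | succ p => exact ⟨p, rfl⟩
      have hq : q + 1 < 2 ^ (q + 1) := Nat.lt_two_pow_self
      rw [key p h, thueMorse, key q hq, ih _ (by omega) p (by omega), ih _ (by omega) q (by omega)]

/-- The Thue–Morse word is the fixed point of the Thue–Morse morphism that starts with `0`. -/
theorem thueMorse_fixed : thueMorse 0 = 0 ∧ tmInf thueMorse = thueMorse := by
  refine ⟨rfl, funext fun n => ?_⟩
  have h : n < 2 ^ n := Nat.lt_two_pow_self
  rw [← getD_tm_iterate (n + 1) n (by omega), Function.iterate_succ_apply',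
    getD_tm _ _ (by rw [length_tm_iterate]; omega), getD_tm_iterate n (n / 2) (by omega)]
  rfl

end BinomialWords

open BinomialWords

namespace BinomialWords

/-! ### Binomial coefficients of words -/

/-! Induct on the level `k`, keeping `x = φᵏ(y)` with fewer than `2ᵏ` letters removed in front. If
every prefix of `y` reoccurs, `x` and `φᵏ(y)` have the same factors. Since `φᵏ(t) = t`, the words
`φᵏ(y)` and `φᵏ(t)` then have equal complexity at level `k + 1`. This must yield one more
desubstitution, `y = φ(z)` up to one letter in front.

The bridge is a description of `∼ₖ₊₁` on long factors of `φᵏ(y)`. Since `φᵏ(0) ∼ₖ φᵏ(1)`, permuting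
the letters of `w` does not change the `∼ₖ₊₁`-class of `φᵏ(w)`. Conversely, the coefficients at the
words `1ʲ0`, packed in a polynomial, show that level `k + 2` also sees the sum of the positions of
the ones of `w`. If `y` has no cube of a letter, the class of a factor therefore amounts to its
offset modulo `2ᵏ`, the weight of the factor of `y` covering it, and the end letters of that cover
that are cut (`beq_iff_sameCover`).

For `k ≥ 1`, a finite check at short lengths excludes cubes. At lengths `2ᵏM` and `2ᵏM + 1` the
complexity counts triples (first letter, weight, last letter) of `y`. Induction on `M` shows that
`y` and `t` have the same triples (`range_triple_eq`). For `k = 0` the abelian complexity is used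
directly. Either way every factor of `y` of length `2p + 1` has weight `p` or `p + 1`, which forces
`y` to split into blocks `01` and `10` after at most one letter (`exists_tmInf_of_oddBalanced`). A
square of a letter in `y` fixes the parity of this splitting, so recurrence of prefixes passes to
`z`. -/

theorem binom_eq_ncard {α : Type*} (u w : List α) :
    binom u w = {i : Fin w.length → Fin u.length | StrictMono i ∧
      ∀ j, u.get (i j) = w.get j}.ncard := rfl

theorem binom_nil_right {α : Type*} (u : List α) : binom u [] = 1 := by
  rw [binom_eq_ncard, Set.ncard_eq_one]
  refine ⟨fun j => j.elim0, Set.eq_singleton_iff_unique_mem.2 ⟨⟨fun j => j.elim0, fun j => j.elim0⟩, ?_⟩⟩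
  intro i _
  funext j
  exact j.elim0

theorem binom_nil_cons {α : Type*} (a : α) (w : List α) : binom [] (a :: w) = 0 := by
  rw [binom_eq_ncard, Set.ncard_eq_zero]
  ext i
  exact (i ⟨0, by simp⟩).elim0

/-- An occurrence either avoids the first letter of `a :: u` (these are the images under `f`) or
uses it for `b` (the images under `g`). -/
theorem binom_cons_cons {α : Type*} [DecidableEq α] (a b : α) (u w : List α) :
    binom (a :: u) (b :: w) = binom u (b :: w) + if a = b then binom u w else 0 := by
  let f : (Fin (w.length + 1) → Fin u.length) → (Fin (w.length + 1) → Fin (u.length + 1)) :=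
    fun i j => (i j).succ
  let g : (Fin w.length → Fin u.length) → (Fin (w.length + 1) → Fin (u.length + 1)) :=
    fun i => Fin.cons 0 fun j => (i j).succ
  have hf : Function.Injective f := fun i i' h => funext fun j =>
    Fin.succ_injective _ (congrFun h j)
  have hg : Function.Injective g := fun i i' h => funext fun j =>
    Fin.succ_injective _ (by simpa [g] using congrFun h j.succ)
  set A := {i : Fin (w.length + 1) → Fin u.length | StrictMono i ∧
    ∀ j, u.get (i j) = (b :: w).get j} with hA
  set B := {i : Fin w.length → Fin u.length | a = b ∧ StrictMono i ∧
    ∀ j, u.get (i j) = w.get j} with hB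
  have hB' : B.ncard = if a = b then binom u w else 0 := by
    split_ifs with h
    · simp [hB, h, binom_eq_ncard]
    · simp [hB, h]
  have hU : {i : Fin (w.length + 1) → Fin (u.length + 1) | StrictMono i ∧
      ∀ j, (a :: u).get (i j) = (b :: w).get j} = f '' A ∪ g '' B := by
    ext i
    constructor
    · rintro ⟨hi, hi'⟩
      by_cases h0 : i 0 = 0
      · right
        have hpos : ∀ j : Fin w.length, i j.succ ≠ 0 := fun j =>
          (lt_of_le_of_lt (Fin.zero_le _) (hi (Fin.succ_pos j))).ne'
        refine ⟨fun j => (i j.succ).pred (hpos j), ⟨?_, ?_, ?_⟩, ?_⟩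
        · have := hi' 0
          rw [h0] at this
          exact this
        · intro j j' hj
          exact Fin.pred_lt_pred_iff.2 (hi (Fin.succ_lt_succ_iff.2 hj))
        · intro j
          have := hi' j.succ
          rw [← Fin.succ_pred (i j.succ) (hpos j)] at this
          exact this
        · funext j
          refine Fin.cases ?_ (fun j => ?_) j
          · exact h0.symm
          · simp [g]
      · left
        have hpos : ∀ j, i j ≠ 0 := fun j =>
          (lt_of_lt_of_le (Fin.pos_of_ne_zero h0) (hi.monotone (Fin.zero_le j))).ne'
        refine ⟨fun j => (i j).pred (hpos j), ⟨?_, ?_⟩, ?_⟩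
        · intro j j' hj
          exact Fin.pred_lt_pred_iff.2 (hi hj)
        · intro j
          have := hi' j
          rw [← Fin.succ_pred (i j) (hpos j)] at this
          exact this
        · funext j
          simp [f]
    · rintro (⟨i, ⟨hi, hi'⟩, rfl⟩ | ⟨i, ⟨hab, hi, hi'⟩, rfl⟩)
      · exact ⟨fun j j' hj => Fin.succ_lt_succ_iff.2 (hi hj), fun j => hi' j⟩
      · refine ⟨?_, ?_⟩
        · intro j j' hj
          induction j using Fin.cases with
          | zero =>
            induction j' using Fin.cases with
            | zero => exact absurd hj (lt_irrefl _)
            | succ j' => simp [g]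
          | succ j =>
            induction j' using Fin.cases with
            | zero => exact absurd hj (by simp)
            | succ j' =>
              simp only [g, Fin.cons_succ]
              exact Fin.succ_lt_succ_iff.2 (hi (Fin.succ_lt_succ_iff.1 hj))
        · intro j
          induction j using Fin.cases with
          | zero => exact hab
          | succ j => exact hi' j
  have hd : Disjoint (f '' A) (g '' B) := by
    rw [Set.disjoint_left]
    rintro _ ⟨i, _, rfl⟩ ⟨i', _, h⟩
    exact Fin.succ_ne_zero _ (congrFun h 0).symm
  calc binom (a :: u) (b :: w) = (f '' A ∪ g '' B).ncard := by rw [← hU]; rfl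
    _ = A.ncard + B.ncard := by
      rw [Set.ncard_union_eq hd (Set.toFinite _) (Set.toFinite _), Set.ncard_image_of_injective _ hf,
        Set.ncard_image_of_injective _ hg]
    _ = _ := by rw [hB']; rfl

/-- An occurrence in `u ++ v` cuts `w` at the point where it passes from `u` to `v`. -/
theorem binom_append {α : Type*} [DecidableEq α] (u v w : List α) :
    binom (u ++ v) w =
      ∑ i ∈ Finset.range (w.length + 1), binom u (w.take i) * binom v (w.drop i) := by
  induction u generalizing w with
  | nil =>
    rw [Finset.sum_range_succ', Finset.sum_eq_zero]
    · simp [binom_nil_right]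
    · intro i hi
      cases w with
      | nil => simp at hi
      | cons b w => simp [binom_nil_cons]
  | cons a u ih =>
    cases w with
    | nil => simp [binom_nil_right]
    | cons b w =>
      rw [List.cons_append, binom_cons_cons, ih, ih, List.length_cons,
        Finset.sum_range_succ' _ (w.length + 1), Finset.sum_range_succ' _ (w.length + 1)]
      simp only [List.take_succ_cons, List.drop_succ_cons, binom_cons_cons, List.take_zero,
        List.drop_zero, binom_nil_right, one_mul]
      simp only [add_mul, Finset.sum_add_distrib]
      split_ifs
      · ring
      · simp

/-! ### Binomial equivalence -/

/-- `k`-binomial equivalence of words. -/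
def BEq {α : Type*} (k : ℕ) (u v : List α) : Prop :=
  ∀ w : List α, w.length ≤ k → binom u w = binom v w

section
variable {α : Type*} {k : ℕ} {u v u' v' : List α}

theorem BEq.refl (u : List α) : BEq k u u := fun _ _ => rfl

theorem BEq.symm (h : BEq k u v) : BEq k v u := fun w hw => (h w hw).symm

theorem BEq.trans (h : BEq k u v) (h' : BEq k v u') : BEq k u u' :=
  fun w hw => (h w hw).trans (h' w hw)

theorem BEq.mono {l : ℕ} (hl : l ≤ k) (h : BEq k u v) : BEq l u v :=
  fun w hw => h w (hw.trans hl)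

variable [DecidableEq α]

theorem BEq.append (h : BEq k u u') (h' : BEq k v v') : BEq k (u ++ v) (u' ++ v') := by
  intro w hw
  rw [binom_append, binom_append]
  refine Finset.sum_congr rfl fun i _ => ?_
  rw [h _ ((List.length_take_le' _ _).trans hw), h' _ (by rw [List.length_drop]; omega)]

/-- In the expansion of `binom (u ++ v) w`, the cut at `0` contributes `binom v w`. All other terms
involve proper suffixes of `w`, which agree by induction and cancel. -/
theorem BEq.of_append_left (h : BEq k (u ++ v) (u ++ v')) : BEq k v v' := by
  intro w
  induction hn : w.length using Nat.strong_induction_on generalizing w with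
  | _ n ih =>
    intro hw
    have := h w (by omega)
    rw [binom_append, binom_append, Finset.sum_range_succ', Finset.sum_range_succ'] at this
    have h' : ∀ i ∈ Finset.range w.length, binom u (w.take (i + 1)) * binom v (w.drop (i + 1)) =
        binom u (w.take (i + 1)) * binom v' (w.drop (i + 1)) := fun i hi => by
      rw [Finset.mem_range] at hi
      rw [ih (w.drop (i + 1)).length (by rw [List.length_drop]; omega) _ rfl
        (by rw [List.length_drop]; omega)]
    rw [Finset.sum_congr rfl h'] at this
    simpa [binom_nil_right] using this

theorem BEq.of_append_right (h : BEq k (u ++ v) (u' ++ v)) : BEq k u u' := by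
  intro w
  induction hn : w.length using Nat.strong_induction_on generalizing w with
  | _ n ih =>
    intro hw
    have := h w (by omega)
    rw [binom_append, binom_append, Finset.sum_range_succ, Finset.sum_range_succ] at this
    have h' : ∀ i ∈ Finset.range w.length, binom u (w.take i) * binom v (w.drop i) =
        binom u' (w.take i) * binom v (w.drop i) := fun i hi => by
      rw [Finset.mem_range] at hi
      rw [ih (w.take i).length (by rw [List.length_take]; omega) _ rfl
        (by rw [List.length_take]; omega)]
    rw [Finset.sum_congr rfl h'] at this
    simpa [binom_nil_right] using this

/-- If both parts of a cut of `w` are nonempty, each has length at most `k`, so `u` and `v` may be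
exchanged. The two extreme cuts together give `binom u w + binom v w`, which is symmetric. -/
theorem BEq.append_comm (h : BEq k u v) : BEq (k + 1) (u ++ v) (v ++ u) := by
  intro w hw
  cases w with
  | nil => simp [binom_nil_right]
  | cons b w =>
    rw [binom_append, binom_append, List.length_cons, Finset.sum_range_succ, Finset.sum_range_succ',
      Finset.sum_range_succ _ (w.length + 1), Finset.sum_range_succ' _ w.length]
    have : ∑ i ∈ Finset.range w.length, binom u ((b :: w).take (i + 1)) *
        binom v ((b :: w).drop (i + 1)) = ∑ i ∈ Finset.range w.length,
        binom v ((b :: w).take (i + 1)) * binom u ((b :: w).drop (i + 1)) := by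
      refine Finset.sum_congr rfl fun i hi => ?_
      rw [Finset.mem_range] at hi
      rw [List.length_cons] at hw
      rw [h _ (by rw [List.length_take, List.length_cons]; omega),
        h _ (by rw [List.length_drop, List.length_cons]; omega)]
    rw [this]
    simp [binom_nil_right, List.take_of_length_le, List.drop_of_length_le]
    ring

end

/-! ### Binomial equivalence of images under `φᵏ` -/

theorem tm_append (u v : List (Fin 2)) : tm (u ++ v) = tm u ++ tm v := by
  simp [tm]

theorem tm_iterate_append (k : ℕ) (u v : List (Fin 2)) :
    tm^[k] (u ++ v) = tm^[k] u ++ tm^[k] v := by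
  induction k with
  | zero => rfl
  | succ k ih => simp only [Function.iterate_succ_apply', ih, tm_append]

theorem tm_iterate_cons (k : ℕ) (a : Fin 2) (u : List (Fin 2)) :
    tm^[k] (a :: u) = tm^[k] [a] ++ tm^[k] u := tm_iterate_append k [a] u

/-- The words `φᵏ(0)` and `φᵏ(1)` are `k`-binomially equivalent. -/
theorem beq_tm_iterate_letter (k : ℕ) (a b : Fin 2) : BEq k (tm^[k] [a]) (tm^[k] [b]) := by
  induction k generalizing a b with
  | zero =>
    intro w hw
    rw [List.length_eq_zero_iff.1 (Nat.le_zero.1 hw), binom_nil_right, binom_nil_right]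
  | succ k ih =>
    have h0 : tm^[k + 1] [0] = tm^[k] [0] ++ tm^[k] [1] := tm_iterate_cons k 0 [1]
    have h1 : tm^[k + 1] [1] = tm^[k] [1] ++ tm^[k] [0] := tm_iterate_cons k 1 [0]
    have h := (ih 0 1).append_comm
    rw [← h0, ← h1] at h
    fin_cases a <;> fin_cases b
    exacts [BEq.refl _, h, h.symm, BEq.refl _]

/-- Exchanging two adjacent letters exchanges two adjacent `k`-equivalent words `φᵏ(a)`, `φᵏ(b)`,
which is harmless at level `k + 1` by `BEq.append_comm`. -/
theorem beq_tm_iterate_of_perm (k : ℕ) {u v : List (Fin 2)} (h : u.Perm v) :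
    BEq (k + 1) (tm^[k] u) (tm^[k] v) := by
  induction h with
  | nil => exact BEq.refl _
  | @cons a u v _ ih =>
    rw [tm_iterate_cons k a u, tm_iterate_cons k a v]
    exact (BEq.refl _).append ih
  | swap a b l =>
    rw [tm_iterate_cons k b (a :: l), tm_iterate_cons k a l, tm_iterate_cons k a (b :: l),
      tm_iterate_cons k b l, ← List.append_assoc, ← List.append_assoc]
    exact (beq_tm_iterate_letter k b a).append_comm.append (BEq.refl _)
  | trans _ _ ih ih' => exact ih.trans ih'

/-- The number of letters `1` in a binary word. -/
def ones (u : List (Fin 2)) : ℕ := (u.map Fin.val).sum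

/-- The sum of the positions of the letters `1` in a binary word. -/
def onesPos : List (Fin 2) → ℕ
  | [] => 0
  | _ :: u => onesPos u + ones u

@[simp] theorem ones_nil : ones [] = 0 := rfl

@[simp] theorem ones_cons (a : Fin 2) (u : List (Fin 2)) : ones (a :: u) = a.val + ones u := by
  simp [ones]

@[simp] theorem ones_append (u v : List (Fin 2)) : ones (u ++ v) = ones u + ones v := by
  simp [ones]

theorem count_one (u : List (Fin 2)) : u.count 1 = ones u := by
  induction u with
  | nil => rfl
  | cons a u ih => fin_cases a <;> simp [ih, add_comm]

theorem count_zero_add_ones (u : List (Fin 2)) : u.count 0 + ones u = u.length := by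
  induction u with
  | nil => rfl
  | cons a u ih => fin_cases a <;> simp <;> omega

theorem beq_tm_iterate (k : ℕ) {u v : List (Fin 2)} (hl : u.length = v.length)
    (h : ones u = ones v) : BEq (k + 1) (tm^[k] u) (tm^[k] v) := by
  refine beq_tm_iterate_of_perm k (List.perm_iff_count.2 fun a => ?_)
  have := count_zero_add_ones u
  have := count_zero_add_ones v
  fin_cases a
  · simp only [Fin.zero_eta]
    omega
  · simp only [Fin.mk_one, count_one, h]

theorem binom_one (u : List (Fin 2)) : binom u [1] = ones u := by
  induction u with
  | nil => exact binom_nil_cons _ _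
  | cons a u ih =>
    rw [binom_cons_cons, ih, binom_nil_right]
    fin_cases a <;> simp [add_comm]

theorem BEq.ones_eq {k : ℕ} {u v : List (Fin 2)} (h : BEq (k + 1) u v) : ones u = ones v := by
  rw [← binom_one, ← binom_one]
  exact h _ (by simp)

/-! ### The generating polynomial of the binomial coefficients of the words `1ʲ0` -/

open Polynomial in
/-- The polynomial whose `j`-th coefficient is the binomial coefficient of `u` and `1ʲ0`. -/
noncomputable def genPoly : List (Fin 2) → ℤ[X]
  | [] => 0
  | a :: u => (if a = 0 then 1 else 0) + (1 + X) ^ a.val * genPoly u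

section
open Polynomial

theorem coeff_genPoly (u : List (Fin 2)) (j : ℕ) :
    (genPoly u).coeff j = binom u (List.replicate j 1 ++ [0]) := by
  induction u generalizing j with
  | nil =>
    cases j with
    | zero => simp [genPoly, binom_nil_cons]
    | succ j => simp [genPoly, List.replicate_succ, binom_nil_cons]
  | cons a u ih =>
    cases j with
    | zero =>
      have := ih 0
      fin_cases a
      · simp_all [genPoly, binom_cons_cons, binom_nil_right, add_comm]
      · simp_all [genPoly, binom_cons_cons, add_mul]
    | succ j =>
      have h0 := ih j
      have h1 := ih (j + 1)
      simp only [List.replicate_succ, List.cons_append] at h1 ⊢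
      rw [binom_cons_cons, Nat.cast_add, ← h1]
      fin_cases a
      · simp [genPoly, coeff_one]
      · simp [genPoly, add_mul, h0]

theorem genPoly_append (u v : List (Fin 2)) :
    genPoly (u ++ v) = genPoly u + (1 + X) ^ ones u * genPoly v := by
  induction u with
  | nil => simp [genPoly]
  | cons a u ih =>
    rw [List.cons_append, genPoly, genPoly, ih, ones_cons, pow_add]
    ring

theorem BEq.X_pow_dvd {k : ℕ} {u v : List (Fin 2)} (h : BEq k u v) :
    (X : ℤ[X]) ^ k ∣ genPoly u - genPoly v := by
  rw [X_pow_dvd_iff]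
  intro d hd
  rw [coeff_sub, coeff_genPoly, coeff_genPoly, h _ (by simpa using hd), sub_self]

/-- The position of a `1` counts the letters before it. Summed over all ones this gives the pairs of
ones plus the coefficient at `01`. The coefficients at `01` and `10` add up to the number of ones
times the number of zeros. -/
theorem coeff_one_genPoly (u : List (Fin 2)) :
    2 * ((onesPos u : ℤ) + (genPoly u).coeff 1) =
      ones u * (ones u - 1) + 2 * ones u * (u.length - ones u) := by
  have h0 : ∀ u : List (Fin 2), (genPoly u).coeff 0 = (u.length : ℤ) - ones u := by
    intro u
    induction u with
    | nil => simp [genPoly]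
    | cons a u ih =>
      fin_cases a
      · simp [genPoly, ih]; ring
      · simp [genPoly, ih, add_mul]; ring
  induction u with
  | nil => simp [genPoly, onesPos]
  | cons a u ih =>
    have := h0 u
    fin_cases a
    · simp [genPoly, onesPos, coeff_one]
      linarith
    · simp [genPoly, onesPos, add_mul, this]
      linarith

theorem ones_tm (u : List (Fin 2)) : ones (tm u) = u.length := by
  induction u with
  | nil => rfl
  | cons a u ih =>
    rw [tm_cons, ones_append, ih]
    fin_cases a <;> simp [tmLetter, add_comm]

theorem length_tm_iterate_eq (k : ℕ) (u : List (Fin 2)) :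
    (tm^[k] u).length = 2 ^ k * u.length := by
  induction k with
  | zero => simp
  | succ k ih => rw [Function.iterate_succ_apply', length_tm, ih, pow_succ]; ring

theorem ones_tm_iterate (k : ℕ) (u : List (Fin 2)) :
    ones (tm^[k + 1] u) = 2 ^ k * u.length := by
  rw [Function.iterate_succ_apply', ones_tm, length_tm_iterate_eq]

/-- The sum of the powers `rⁱ`, over the positions `i` of the letters `1`. -/
noncomputable def onesSum (r : ℤ[X]) : List (Fin 2) → ℤ[X]
  | [] => 0
  | a :: u => (a.val : ℤ[X]) + r * onesSum r u

/-- Modulo `X²`, `(1 + X) ^ (m * i)` is `1 + m * i * X`, so the linear coefficient recovers the sum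
of positions. -/
theorem coeff_onesSum (m : ℕ) (u : List (Fin 2)) :
    (onesSum ((1 + X) ^ m) u).coeff 0 = ones u ∧
      (onesSum ((1 + X) ^ m) u).coeff 1 = m * onesPos u := by
  have h1 : ((1 + X : ℤ[X]) ^ m).coeff 1 = m := by
    rw [coeff_one_add_X_pow, Nat.choose_one_right]
  have h0 : ((1 + X : ℤ[X]) ^ m).coeff 0 = 1 := by
    rw [coeff_one_add_X_pow, Nat.choose_zero_right, Nat.cast_one]
  have hc : ∀ n : ℕ, (n : ℤ[X]).coeff 0 = n ∧ (n : ℤ[X]).coeff 1 = 0 := fun n => by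
    rw [← C_eq_natCast]
    simp
  induction u with
  | nil => simp [onesSum, onesPos]
  | cons a u ih =>
    rw [onesSum, coeff_add, coeff_add, mul_coeff_zero, mul_coeff_one, h0, h1, ih.1, ih.2,
      (hc _).1, (hc _).2, ones_cons, onesPos]
    push_cast
    constructor <;> ring

/-- The difference vanishes at `0` to order exactly `k + 1`. For words `A`, `B` with `s` ones each,
the polynomials of `BA` and `AB` differ by `1 - (1 + X)ˢ` times the difference of those of `B` and
`A`. This factor has a simple zero at `0`. -/
theorem genPoly_tm_iterate_sub (k : ℕ) :
    ∃ q : ℤ[X], q.coeff 0 ≠ 0 ∧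
      genPoly (tm^[k + 1] [1]) - genPoly (tm^[k + 1] [0]) = X ^ (k + 1) * q := by
  induction k with
  | zero =>
    refine ⟨1, by simp, ?_⟩
    simp [tm, tmLetter, genPoly]
  | succ k ih =>
    obtain ⟨q, hq, h⟩ := ih
    have h0 : tm^[k + 2] [0] = tm^[k + 1] [0] ++ tm^[k + 1] [1] := tm_iterate_cons (k + 1) 0 [1]
    have h1 : tm^[k + 2] [1] = tm^[k + 1] [1] ++ tm^[k + 1] [0] := tm_iterate_cons (k + 1) 1 [0]
    obtain ⟨p, hp⟩ : (X : ℤ[X]) ∣ 1 - (1 + X) ^ (2 ^ k) := by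
      rw [X_dvd_iff]
      simp [coeff_one_add_X_pow]
    have hp0 : p.coeff 0 = -2 ^ k := by
      have := congrArg (fun f => f.coeff 1) hp
      simpa [coeff_one_add_X_pow, coeff_one, coeff_X_mul, eq_comm] using this
    refine ⟨p * q, ?_, ?_⟩
    · rw [mul_coeff_zero, hp0]
      exact mul_ne_zero (by simp) hq
    · rw [h0, h1, genPoly_append, genPoly_append, ones_tm_iterate, ones_tm_iterate]
      simp only [List.length_singleton, mul_one]
      calc _ = (1 - (1 + X) ^ (2 ^ k)) *
            (genPoly (tm^[k + 1] [1]) - genPoly (tm^[k + 1] [0])) := by ring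
        _ = _ := by rw [h, hp]; ring

/-- For positive `k` all blocks `φᵏ(a)` have the same number of ones, so the difference of
polynomials factors as `Xᵏ * q` times a difference of values of `onesSum`, with `q.coeff 0 ≠ 0`.
Divisibility by `Xᵏ⁺²` kills the linear coefficient of the last factor. For `k = 0` the coefficient
at `10` is read directly. -/
theorem onesPos_eq_of_beq (k : ℕ) {u v : List (Fin 2)} (hl : u.length = v.length)
    (ho : ones u = ones v) (h : BEq (k + 2) (tm^[k] u) (tm^[k] v)) : onesPos u = onesPos v := by
  have hd := h.X_pow_dvd
  cases k with
  | zero =>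
    have h1 := coeff_one_genPoly u
    have h2 := coeff_one_genPoly v
    have h3 := (X_pow_dvd_iff.1 hd) 1 (by norm_num)
    simp only [Function.iterate_zero, id_eq, coeff_sub] at h3
    rw [hl, ho] at h1
    have : (onesPos u : ℤ) = onesPos v := by linarith
    exact_mod_cast this
  | succ k =>
    obtain ⟨q, hq, hs⟩ := genPoly_tm_iterate_sub k
    have key : ∀ u v : List (Fin 2), u.length = v.length →
        genPoly (tm^[k + 1] u) - genPoly (tm^[k + 1] v) = X ^ (k + 1) * q *
          (onesSum ((1 + X) ^ (2 ^ k)) u - onesSum ((1 + X) ^ (2 ^ k)) v) := by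
      intro u
      induction u with
      | nil =>
        intro v hv
        rw [List.length_eq_zero_iff.1 hv.symm]
        simp
      | cons a u ih =>
        intro v hv
        cases v with
        | nil => simp at hv
        | cons b v =>
          rw [tm_iterate_cons, tm_iterate_cons (k + 1) b, genPoly_append, genPoly_append,
            ones_tm_iterate, ones_tm_iterate, onesSum, onesSum]
          simp only [List.length_singleton, mul_one]
          have h1 := ih v (by simpa using hv)
          have h2 : genPoly (tm^[k + 1] [a]) - genPoly (tm^[k + 1] [b]) =
              X ^ (k + 1) * q * ((a.val : ℤ[X]) - (b.val : ℤ[X])) := by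
            fin_cases a <;> fin_cases b <;> simp [← hs]
          linear_combination h2 + (1 + X) ^ (2 ^ k) * h1
    rw [key u v hl, show k + 1 + 2 = (k + 1) + 2 from rfl, pow_add, mul_assoc] at hd
    have hd' := (mul_dvd_mul_iff_left (pow_ne_zero (k + 1) (X_ne_zero (R := ℤ)))).1 hd
    have hd'' := prime_X.pow_dvd_of_dvd_mul_left 2 (by rwa [X_dvd_iff]) hd'
    have h1 := (X_pow_dvd_iff.1 hd'') 1 (by norm_num)
    rw [coeff_sub, (coeff_onesSum _ u).2, (coeff_onesSum _ v).2, ← mul_sub, mul_eq_zero] at h1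
    rcases h1 with h1 | h1
    · simp at h1
    · exact_mod_cast sub_eq_zero.1 h1

end

/-! ### Weights of blocks of infinite words -/

theorem block_succ_left {α : Type*} (x : ℕ → α) (q n : ℕ) :
    block x q (n + 1) = x q :: block x (q + 1) n := by
  simp only [block, List.ofFn_succ]
  congr 1
  refine congrArg List.ofFn (funext fun i => congrArg x ?_)
  simp
  ring

theorem block_eq_iff {α : Type*} (x : ℕ → α) (q q' n : ℕ) :
    block x q n = block x q' n ↔ ∀ i < n, x (q + i) = x (q' + i) := by
  simp only [block, List.ofFn_inj, funext_iff, Fin.forall_iff]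

theorem block_add {α : Type*} (x : ℕ → α) (q m n : ℕ) :
    block x q (m + n) = block x q m ++ block x (q + m) n := by
  simp [block, List.ofFn_add, add_assoc]

@[simp] theorem length_block {α : Type*} (x : ℕ → α) (q n : ℕ) : (block x q n).length = n := by
  simp [block]

/-- The number of letters `1` of `x` at the positions `q, …, q + n - 1`. -/
def wt (x : ℕ → Fin 2) (q n : ℕ) : ℕ := ∑ i ∈ Finset.range n, (x (q + i)).val

/-- The sum of the positions, relative to `q`, of the letters `1` of `x` at the positions
`q, …, q + n - 1`. -/
def wtPos (x : ℕ → Fin 2) (q n : ℕ) : ℕ := ∑ i ∈ Finset.range n, i * (x (q + i)).val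

theorem wt_zero (x : ℕ → Fin 2) (q : ℕ) : wt x q 0 = 0 := rfl

theorem wt_one (x : ℕ → Fin 2) (q : ℕ) : wt x q 1 = (x q).val := by simp [wt]

theorem wt_succ_right (x : ℕ → Fin 2) (q n : ℕ) :
    wt x q (n + 1) = wt x q n + (x (q + n)).val := Finset.sum_range_succ _ _

theorem wt_succ_left (x : ℕ → Fin 2) (q n : ℕ) :
    wt x q (n + 1) = (x q).val + wt x (q + 1) n := by
  rw [wt, Finset.sum_range_succ', wt, add_comm]
  simp [add_comm, add_left_comm]

theorem wtPos_succ_right (x : ℕ → Fin 2) (q n : ℕ) :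
    wtPos x q (n + 1) = wtPos x q n + n * (x (q + n)).val := Finset.sum_range_succ _ _

theorem wtPos_succ_left (x : ℕ → Fin 2) (q n : ℕ) :
    wtPos x q (n + 1) = wtPos x (q + 1) n + wt x (q + 1) n := by
  rw [wtPos, Finset.sum_range_succ', wtPos, wt, ← Finset.sum_add_distrib]
  simp only [zero_mul, add_zero]
  refine Finset.sum_congr rfl fun i _ => ?_
  rw [show q + (i + 1) = q + 1 + i by ring]
  ring

theorem val_le_one (a : Fin 2) : a.val ≤ 1 := by omega

theorem wt_le (x : ℕ → Fin 2) (q n : ℕ) : wt x q n ≤ n := by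
  induction n with
  | zero => exact le_rfl
  | succ n ih =>
    have := val_le_one (x (q + n))
    rw [wt_succ_right]
    omega

theorem ones_block (x : ℕ → Fin 2) (q n : ℕ) : ones (block x q n) = wt x q n := by
  induction n generalizing q with
  | zero => rfl
  | succ n ih => rw [block_succ_left, ones_cons, ih, wt_succ_left]

theorem onesPos_block (x : ℕ → Fin 2) (q n : ℕ) : onesPos (block x q n) = wtPos x q n := by
  induction n generalizing q with
  | zero => rfl
  | succ n ih => rw [block_succ_left, onesPos, ih, ones_block, wtPos_succ_left]

theorem eq_zero_of_wt_eq_zero {x : ℕ → Fin 2} {q n : ℕ} (h : wt x q n = 0) {i : ℕ} (hi : i < n) :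
    x (q + i) = 0 := by
  have := (Finset.sum_eq_zero_iff.1 h) i (Finset.mem_range.2 hi)
  exact Fin.ext this

theorem eq_one_of_wt_eq {x : ℕ → Fin 2} {q n : ℕ} (h : wt x q n = n) {i : ℕ} (hi : i < n) :
    x (q + i) = 1 := by
  induction n with
  | zero => omega
  | succ n ih =>
    rw [wt_succ_right] at h
    have h1 := wt_le x q n
    have h2 := val_le_one (x (q + n))
    rcases Nat.lt_succ_iff_lt_or_eq.1 hi with h3 | rfl
    · exact ih (by omega) h3
    · exact Fin.ext (by simp; omega)

/-! ### Images under the Thue–Morse morphism -/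

theorem tmInf_even (y : ℕ → Fin 2) (h : ℕ) : tmInf y (2 * h) = y h := by
  have h1 : 2 * h / 2 = h := by omega
  have h2 : 2 * h % 2 = 0 := by omega
  rw [tmInf, h1, h2]
  generalize y h = a
  fin_cases a <;> rfl

theorem tmInf_odd (y : ℕ → Fin 2) (h : ℕ) : tmInf y (2 * h + 1) = 1 - y h := by
  have h1 : (2 * h + 1) / 2 = h := by omega
  have h2 : (2 * h + 1) % 2 = 1 := by omega
  rw [tmInf, h1, h2]
  generalize y h = a
  fin_cases a <;> rfl

theorem val_one_sub (a : Fin 2) : (1 - a).val + a.val = 1 := by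
  fin_cases a <;> rfl

theorem val_tmInf_odd (y : ℕ → Fin 2) (h : ℕ) :
    (tmInf y (2 * h + 1)).val + (y h).val = 1 := by
  rw [tmInf_odd, val_one_sub]

theorem wt_tmInf_even_even (y : ℕ → Fin 2) (h m : ℕ) : wt (tmInf y) (2 * h) (2 * m) = m := by
  induction m with
  | zero => rfl
  | succ m ih =>
    have := val_tmInf_odd y (h + m)
    rw [show 2 * (m + 1) = 2 * m + 1 + 1 by ring, wt_succ_right, wt_succ_right, ih,
      show 2 * h + 2 * m = 2 * (h + m) by ring,
      show 2 * h + (2 * m + 1) = 2 * (h + m) + 1 by ring, tmInf_even]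
    omega

theorem wt_tmInf_even_odd (y : ℕ → Fin 2) (h m : ℕ) :
    wt (tmInf y) (2 * h) (2 * m + 1) = m + (y (h + m)).val := by
  rw [wt_succ_right, wt_tmInf_even_even, show 2 * h + 2 * m = 2 * (h + m) by ring, tmInf_even]

theorem wt_tmInf_odd_odd (y : ℕ → Fin 2) (h m : ℕ) :
    wt (tmInf y) (2 * h + 1) (2 * m + 1) + (y h).val = m + 1 := by
  have := val_tmInf_odd y h
  rw [wt_succ_left, show 2 * h + 1 + 1 = 2 * (h + 1) by ring, wt_tmInf_even_even]
  omega

theorem wt_tmInf_odd_even (y : ℕ → Fin 2) (h m : ℕ) :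
    wt (tmInf y) (2 * h + 1) (2 * (m + 1)) + (y h).val = m + 1 + (y (h + 1 + m)).val := by
  have := wt_tmInf_odd_odd y h m
  rw [show 2 * (m + 1) = 2 * m + 1 + 1 by ring, wt_succ_right,
    show 2 * h + 1 + (2 * m + 1) = 2 * (h + 1 + m) by ring, tmInf_even]
  omega

/-- The `i`-th image block contributes `2i + 1` minus its source letter. Thus position sums in
`φ(y)` encode weights in `y`. -/
theorem wtPos_tmInf_even_even (y : ℕ → Fin 2) (h m : ℕ) :
    wtPos (tmInf y) (2 * h) (2 * m) + wt y h m = m * m := by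
  induction m with
  | zero => rfl
  | succ m ih =>
    have h1 := val_tmInf_odd y (h + m)
    rw [show 2 * (m + 1) = 2 * m + 1 + 1 by ring, wtPos_succ_right, wtPos_succ_right,
      show 2 * h + 2 * m = 2 * (h + m) by ring, wt_succ_right,
      show 2 * h + (2 * m + 1) = 2 * (h + m) + 1 by ring, tmInf_even]
    have h2 : (2 * m + 1) * (tmInf y (2 * (h + m) + 1)).val + (2 * m + 1) * (y (h + m)).val =
        2 * m + 1 := by rw [← mul_add, h1, mul_one]
    linarith

theorem wtPos_tmInf_even_odd (y : ℕ → Fin 2) (h m : ℕ) :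
    wtPos (tmInf y) (2 * h) (2 * m + 1) + wt y h m = m * m + 2 * m * (y (h + m)).val := by
  have := wtPos_tmInf_even_even y h m
  rw [wtPos_succ_right, show 2 * h + 2 * m = 2 * (h + m) by ring, tmInf_even]
  omega

theorem wtPos_tmInf_odd_odd (y : ℕ → Fin 2) (h m : ℕ) :
    wtPos (tmInf y) (2 * h + 1) (2 * m + 1) + wt y (h + 1) m = m * m + m := by
  have := wtPos_tmInf_even_even y (h + 1) m
  rw [wtPos_succ_left, show 2 * h + 1 + 1 = 2 * (h + 1) by ring, wt_tmInf_even_even]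
  omega

theorem wtPos_tmInf_odd_even (y : ℕ → Fin 2) (h m : ℕ) :
    wtPos (tmInf y) (2 * h + 1) (2 * (m + 1)) + wt y (h + 1) m =
      m * m + m + (2 * m + 1) * (y (h + 1 + m)).val := by
  have := wtPos_tmInf_odd_odd y h m
  rw [show 2 * (m + 1) = 2 * m + 1 + 1 by ring, wtPos_succ_right,
    show 2 * h + 1 + (2 * m + 1) = 2 * (h + 1 + m) by ring, tmInf_even]
  omega

/-- The word `y` contains no cube of a letter. -/
def CubeFree (y : ℕ → Fin 2) : Prop := ∀ i, y i = y (i + 1) → y (i + 1) ≠ y (i + 2)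

/-- Of the pairs `i, i + 1` and `i + 1, i + 2`, one is the image of a single letter, and its two
letters differ. -/
theorem cubeFree_tmInf (y : ℕ → Fin 2) : CubeFree (tmInf y) := by
  have key : ∀ m, tmInf y (2 * m) ≠ tmInf y (2 * m + 1) := fun m h => by
    have h1 := val_tmInf_odd y m
    rw [← h, tmInf_even] at h1
    omega
  intro i h1 h2
  obtain ⟨m, rfl | rfl⟩ := Nat.even_or_odd' i
  · exact key m h1
  · exact key (m + 1) h2

/-! ### Parses of factors of `φ(y)` -/

/-- The number of blocks of length `N` that are needed to cover `n` positions, the first of which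
is the position `r` of a block. -/
def cover (N n r : ℕ) : ℕ := (r + n + N - 1) / N

/-- The blocks of length `n` at the positions `N * h + r` and `N * h' + r` of the image of `y`
under a morphism of constant length `N` come from factors of `y` that have the same weight, and
the same first and last letters if the images of these letters are not contained in the blocks. -/
def SameCover (N n : ℕ) (y : ℕ → Fin 2) (r h h' : ℕ) : Prop :=
  wt y h (cover N n r) = wt y h' (cover N n r) ∧ (r ≠ 0 → y h = y h') ∧
    (¬ N ∣ r + n → y (h + (r + n) / N) = y (h' + (r + n) / N))

theorem cover_mul_sub {N n r a c : ℕ} (hN : 0 < N) (hc : c < N) (h : r + n = N * a + c) :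
    (r + n) / N = a ∧ (N ∣ r + n ↔ c = 0) ∧ cover N n r = a + if c = 0 then 0 else 1 := by
  refine ⟨?_, ?_, ?_⟩
  · rw [h, Nat.mul_add_div hN, Nat.div_eq_of_lt hc, add_zero]
  · rw [h, Nat.dvd_add_right (dvd_mul_right _ _)]
    exact ⟨fun h => Nat.eq_zero_of_dvd_of_lt h hc, fun h => h ▸ dvd_zero _⟩
  · rw [cover, h]
    split_ifs with h0
    · rw [h0, show N * a + 0 + N - 1 = N * a + (N - 1) by omega, Nat.mul_add_div hN,
        Nat.div_eq_of_lt (by omega)]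
    · rw [show N * a + c + N - 1 = N * (a + 1) + (c - 1) by rw [mul_add]; omega,
        Nat.mul_add_div hN, Nat.div_eq_of_lt (by omega), add_zero]

/-- Equating the weight and position formulas for the two parities makes two weights in `y` differ
as much as their lengths allow. One is therefore zero and the other maximal, so `y` is constant on
both covers, with opposite letters. -/
theorem wt_tmInf_misaligned {y : ℕ → Fin 2} {g g' L : ℕ} (hL : 4 ≤ L)
    (h1 : wt (tmInf y) (2 * g) L = wt (tmInf y) (2 * g' + 1) L)
    (h2 : wtPos (tmInf y) (2 * g) L = wtPos (tmInf y) (2 * g' + 1) L) :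
    ∃ c, (∀ i, 2 * i < L → y (g + i) = c) ∧ ∀ i, 2 * i < L + 1 → y (g' + i) = 1 - c := by
  obtain ⟨m, rfl | rfl⟩ := Nat.even_or_odd' L
  · obtain ⟨m, rfl⟩ : ∃ p, m = p + 1 := ⟨m - 1, by omega⟩
    have e1 := wt_tmInf_even_even y g (m + 1)
    have e2 := wt_tmInf_odd_even y g' m
    have e3 := wtPos_tmInf_even_even y g (m + 1)
    have e4 := wtPos_tmInf_odd_even y g' m
    have w1 := wt_le y g (m + 1)
    have w2 := wt_le y (g' + 1) m
    have b1 := val_le_one (y g')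
    have b2 := val_le_one (y (g' + 1 + m))
    rw [h1] at e1
    rw [h2] at e3
    rcases Nat.le_one_iff_eq_zero_or_eq_one.1 b2 with hb | hb
    · rw [hb] at e2 e4
      refine ⟨1, fun i hi => eq_one_of_wt_eq (n := m + 1) (by linarith) (by omega), fun i hi => ?_⟩
      have e5 : wt y (g' + 1) m = 0 := by linarith
      rcases Nat.eq_zero_or_pos i with rfl | hi0
      · exact Fin.ext (by simp; omega)
      · obtain ⟨i, rfl⟩ : ∃ p, i = p + 1 := ⟨i - 1, by omega⟩
        rcases Nat.lt_or_ge i m with him | him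
        · rw [show g' + (i + 1) = g' + 1 + i by ring, eq_zero_of_wt_eq_zero e5 him]
          rfl
        · rw [show g' + (i + 1) = g' + 1 + m by omega]
          exact Fin.ext (by simp [hb])
    · rw [hb] at e2 e4
      refine ⟨0, fun i hi => eq_zero_of_wt_eq_zero (n := m + 1) (by linarith) (by omega), fun i hi => ?_⟩
      have e5 : wt y (g' + 1) m = m := by linarith
      rcases Nat.eq_zero_or_pos i with rfl | hi0
      · exact Fin.ext (by simp; omega)
      · obtain ⟨i, rfl⟩ : ∃ p, i = p + 1 := ⟨i - 1, by omega⟩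
        rcases Nat.lt_or_ge i m with him | him
        · rw [show g' + (i + 1) = g' + 1 + i by ring, eq_one_of_wt_eq e5 him]
          rfl
        · rw [show g' + (i + 1) = g' + 1 + m by omega]
          exact Fin.ext (by simp [hb])
  · have e1 := wt_tmInf_even_odd y g m
    have e2 := wt_tmInf_odd_odd y g' m
    have e3 := wtPos_tmInf_even_odd y g m
    have e4 := wtPos_tmInf_odd_odd y g' m
    have w1 := wt_le y g m
    have w2 := wt_le y (g' + 1) m
    have b1 := val_le_one (y g')
    have b2 := val_le_one (y (g + m))
    rw [h1] at e1
    rw [h2] at e3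
    rcases Nat.le_one_iff_eq_zero_or_eq_one.1 b2 with hb | hb
    · rw [hb] at e1 e3
      have e5 : wt y (g' + 1) m = m := by linarith
      have e6 : wt y g m = 0 := by linarith
      refine ⟨0, fun i hi => ?_, fun i hi => ?_⟩
      · rcases Nat.lt_or_ge i m with him | him
        · exact eq_zero_of_wt_eq_zero e6 him
        · rw [show i = m by omega]
          exact Fin.ext (by simp [hb])
      · rcases Nat.eq_zero_or_pos i with rfl | hi0
        · exact Fin.ext (by simp; omega)
        · obtain ⟨i, rfl⟩ : ∃ p, i = p + 1 := ⟨i - 1, by omega⟩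
          rw [show g' + (i + 1) = g' + 1 + i by ring, eq_one_of_wt_eq e5 (by omega)]
          rfl
    · rw [hb] at e1 e3
      have e5 : wt y (g' + 1) m = 0 := by linarith
      have e6 : wt y g m = m := by linarith
      refine ⟨1, fun i hi => ?_, fun i hi => ?_⟩
      · rcases Nat.lt_or_ge i m with him | him
        · exact eq_one_of_wt_eq e6 him
        · rw [show i = m by omega]
          exact Fin.ext (by simp [hb])
      · rcases Nat.eq_zero_or_pos i with rfl | hi0
        · exact Fin.ext (by simp; omega)
        · obtain ⟨i, rfl⟩ : ∃ p, i = p + 1 := ⟨i - 1, by omega⟩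
          rw [show g' + (i + 1) = g' + 1 + i by ring, eq_zero_of_wt_eq_zero e5 (by omega)]
          rfl

theorem block_eq_of_misaligned {y : ℕ → Fin 2} {g g' L : ℕ} {c : Fin 2}
    (h : ∀ i, 2 * i < L → y (g + i) = c) (h' : ∀ i, 2 * i < L + 1 → y (g' + i) = 1 - c) :
    block (tmInf y) (2 * g) L = block (tmInf y) (2 * g' + 1) L := by
  rw [block_eq_iff]
  intro i hi
  obtain ⟨m, rfl | rfl⟩ := Nat.even_or_odd' i
  · rw [show 2 * g + 2 * m = 2 * (g + m) by ring,
      show 2 * g' + 1 + 2 * m = 2 * (g' + m) + 1 by ring, tmInf_even, tmInf_odd, h m hi,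
      h' m (by omega)]
    simp
  · rw [show 2 * g + (2 * m + 1) = 2 * (g + m) + 1 by ring,
      show 2 * g' + 1 + (2 * m + 1) = 2 * (g' + (m + 1)) by ring, tmInf_even, tmInf_odd,
      h m (by omega), h' (m + 1) (by omega)]

theorem wt_tmInf_aligned {y : ℕ → Fin 2} {g g' e L : ℕ} (he : e < 2) (hL : 4 ≤ L)
    (h1 : wt (tmInf y) (2 * g + e) L = wt (tmInf y) (2 * g' + e) L)
    (h2 : wtPos (tmInf y) (2 * g + e) L = wtPos (tmInf y) (2 * g' + e) L) :
    SameCover 2 L y e g g' := by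
  obtain ⟨m, rfl | rfl⟩ := Nat.even_or_odd' L
  · obtain rfl | rfl : e = 0 ∨ e = 1 := by omega
    · have e3 := wtPos_tmInf_even_even y g m
      have e4 := wtPos_tmInf_even_even y g' m
      obtain ⟨s1, s2, s3⟩ := cover_mul_sub (N := 2) (n := 2 * m) (r := 0) (a := m) (c := 0)
        (by norm_num) (by norm_num) (by omega)
      rw [SameCover, s1, s2, s3]
      simp only [add_zero] at h1 h2
      rw [h2] at e3
      exact ⟨by simp only [if_true, add_zero]; omega, by simp, by simp⟩
    · obtain ⟨m, rfl⟩ : ∃ p, m = p + 1 := ⟨m - 1, by omega⟩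
      have e1 := wt_tmInf_odd_even y g m
      have e2 := wt_tmInf_odd_even y g' m
      have e3 := wtPos_tmInf_odd_even y g m
      have e4 := wtPos_tmInf_odd_even y g' m
      obtain ⟨s1, s2, s3⟩ := cover_mul_sub (N := 2) (n := 2 * (m + 1)) (r := 1) (a := m + 1)
        (c := 1) (by norm_num) (by norm_num) (by omega)
      rw [SameCover, s1, s2, s3]
      have w1 := wt_le y (g + 1) m
      have w2 := wt_le y (g' + 1) m
      have b1 := val_le_one (y (g + 1 + m))
      have b2 := val_le_one (y (g' + 1 + m))
      -- The last letter has coefficient `2m + 1`, while the weights of the `m` inner letters differ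
      -- by at most `m`, so it can be read off.
      have e5 : (y (g + 1 + m)).val = (y (g' + 1 + m)).val := by
        rw [h2] at e3
        rcases Nat.le_one_iff_eq_zero_or_eq_one.1 b1 with hb | hb <;>
        rcases Nat.le_one_iff_eq_zero_or_eq_one.1 b2 with hb' | hb' <;> rw [hb] at e3 <;>
        rw [hb'] at e4 <;> omega
      have e6 : (y g).val = (y g').val := by omega
      rw [e5] at e3
      refine ⟨?_, fun _ => Fin.ext e6, fun _ => ?_⟩
      · simp only [one_ne_zero, if_false]
        rw [wt_succ_left, wt_succ_right, wt_succ_left y g', wt_succ_right y (g' + 1)]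
        omega
      · rw [show g + (m + 1) = g + 1 + m by ring, show g' + (m + 1) = g' + 1 + m by ring]
        exact Fin.ext e5
  · obtain rfl | rfl : e = 0 ∨ e = 1 := by omega
    · have e1 := wt_tmInf_even_odd y g m
      have e2 := wt_tmInf_even_odd y g' m
      have e3 := wtPos_tmInf_even_odd y g m
      have e4 := wtPos_tmInf_even_odd y g' m
      obtain ⟨s1, s2, s3⟩ := cover_mul_sub (N := 2) (n := 2 * m + 1) (r := 0) (a := m) (c := 1)
        (by norm_num) (by norm_num) (by omega)
      rw [SameCover, s1, s2, s3]
      simp only [add_zero] at h1 h2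
      have e5 : (y (g + m)).val = (y (g' + m)).val := by omega
      rw [e5, h2] at e3
      refine ⟨?_, by simp, fun _ => Fin.ext e5⟩
      simp only [one_ne_zero, if_false]
      rw [wt_succ_right, wt_succ_right]
      omega
    · have e1 := wt_tmInf_odd_odd y g m
      have e2 := wt_tmInf_odd_odd y g' m
      have e3 := wtPos_tmInf_odd_odd y g m
      have e4 := wtPos_tmInf_odd_odd y g' m
      obtain ⟨s1, s2, s3⟩ := cover_mul_sub (N := 2) (n := 2 * m + 1) (r := 1) (a := m + 1)
        (c := 0) (by norm_num) (by norm_num) (by omega)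
      rw [SameCover, s1, s2, s3]
      refine ⟨?_, fun _ => Fin.ext (by omega), by simp⟩
      simp only [if_true, add_zero]
      rw [wt_succ_left, wt_succ_left]
      omega

/-- Factors of `φ(y)` of the same length, weight and sum of positions of the letters `1` either
have the same parse, or are equal words; in the latter case `y` contains the cube of a letter. -/
theorem wt_tmInf_dichotomy {y : ℕ → Fin 2} {g g' e e' L : ℕ} (he : e < 2) (he' : e' < 2)
    (hL : 4 ≤ L) (h1 : wt (tmInf y) (2 * g + e) L = wt (tmInf y) (2 * g' + e') L)
    (h2 : wtPos (tmInf y) (2 * g + e) L = wtPos (tmInf y) (2 * g' + e') L) :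
    (e = e' ∧ SameCover 2 L y e g g') ∨
      (block (tmInf y) (2 * g + e) L = block (tmInf y) (2 * g' + e') L ∧ ¬ CubeFree y) := by
  have key : ∀ {g' : ℕ} {c : Fin 2}, (∀ i, 2 * i < L + 1 → y (g' + i) = c) → ¬ CubeFree y := by
    intro g' c h hc
    -- A block of length at least four that starts at an odd position meets at least three letters
    -- of `y`.
    have i0 := h 0 (by omega)
    have i1 := h 1 (by omega)
    have i2 := h 2 (by omega)
    exact hc g' (by rw [i1]; exact i0) (by rw [i1, i2])
  obtain rfl | rfl : e = 0 ∨ e = 1 := by omega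
  · obtain rfl | rfl : e' = 0 ∨ e' = 1 := by omega
    · exact Or.inl ⟨rfl, wt_tmInf_aligned (by omega) hL h1 h2⟩
    · obtain ⟨c, h3, h4⟩ := wt_tmInf_misaligned hL h1 h2
      exact Or.inr ⟨block_eq_of_misaligned h3 h4, key h4⟩
  · obtain rfl | rfl : e' = 0 ∨ e' = 1 := by omega
    · obtain ⟨c, h3, h4⟩ := wt_tmInf_misaligned hL h1.symm h2.symm
      exact Or.inr ⟨(block_eq_of_misaligned h3 h4).symm, key h4⟩
    · exact Or.inl ⟨rfl, wt_tmInf_aligned (by omega) hL h1 h2⟩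

/-! ### Factors of iterated images under the Thue–Morse morphism -/

theorem tmInf_shift (y : ℕ → Fin 2) (h i : ℕ) :
    tmInf (fun j => y (h + j)) i = tmInf y (2 * h + i) := by
  have h1 : (2 * h + i) / 2 = h + i / 2 := by omega
  have h2 : (2 * h + i) % 2 = i % 2 := by omega
  rw [tmInf, tmInf, h1, h2]

theorem block_tmInf_two_mul (y : ℕ → Fin 2) (h n : ℕ) :
    block (tmInf y) (2 * h) (2 * n) = tm (block y h n) := by
  have h1 := block_tmInf (fun j => y (h + j)) n
  simp only [block, tmInf_shift, zero_add] at h1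
  exact h1

theorem block_tmInf_iterate (k : ℕ) (y : ℕ → Fin 2) (h n : ℕ) :
    block (tmInf^[k] y) (2 ^ k * h) (2 ^ k * n) = tm^[k] (block y h n) := by
  induction k with
  | zero => simp
  | succ k ih =>
    rw [Function.iterate_succ_apply', Function.iterate_succ_apply', ← ih, ← block_tmInf_two_mul,
      pow_succ]
    congr 1 <;> ring

theorem tmInf_iterate_congr (k : ℕ) (y : ℕ → Fin 2) {h h' i : ℕ} (hi : i < 2 ^ k)
    (hy : y h = y h') : tmInf^[k] y (2 ^ k * h + i) = tmInf^[k] y (2 ^ k * h' + i) := by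
  induction k generalizing i with
  | zero => simpa [Nat.lt_one_iff.1 hi] using hy
  | succ k ih =>
    rw [pow_succ] at hi ⊢
    have key : ∀ h, (2 ^ k * 2 * h + i) / 2 = 2 ^ k * h + i / 2 ∧
        (2 ^ k * 2 * h + i) % 2 = i % 2 := fun h => by
      rw [show 2 ^ k * 2 * h = 2 * (2 ^ k * h) by ring]
      omega
    rw [Function.iterate_succ_apply', tmInf, tmInf, (key h).1, (key h).2, (key h').1, (key h').2,
      ih (by omega)]

theorem div_decomp {N : ℕ} (hN : 0 < N) (m : ℕ) : ∃ a c, c < N ∧ m = N * a + c :=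
  ⟨m / N, m % N, Nat.mod_lt _ hN, (Nat.div_add_mod _ _).symm⟩

/-- Complete the block by `r` letters on the left and `s` on the right to the full image of its
cover. Equal end letters make the completions equal, and they can be added or cancelled. -/
theorem beq_block_iff {k n K : ℕ} {y : ℕ → Fin 2} {r h h' : ℕ} (hr : r < 2 ^ k)
    (h1 : r ≠ 0 → y h = y h')
    (h2 : ¬ 2 ^ k ∣ r + n → y (h + (r + n) / 2 ^ k) = y (h' + (r + n) / 2 ^ k)) :
    BEq K (block (tmInf^[k] y) (2 ^ k * h + r) n) (block (tmInf^[k] y) (2 ^ k * h' + r) n) ↔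
      BEq K (tm^[k] (block y h (cover (2 ^ k) n r))) (tm^[k] (block y h' (cover (2 ^ k) n r))) := by
  obtain ⟨a, c, hc, hac⟩ := div_decomp (Nat.two_pow_pos k) (r + n)
  obtain ⟨s1, s2, s3⟩ := cover_mul_sub (Nat.two_pow_pos k) hc hac
  rw [s1, s2] at h2
  obtain ⟨s, hs⟩ : ∃ s, 2 ^ k * cover (2 ^ k) n r = r + (n + s) := by
    refine ⟨2 ^ k * cover (2 ^ k) n r - (r + n), ?_⟩
    rw [s3]
    split_ifs <;> simp only [mul_add] <;> omega
  have hsplit : ∀ h, tm^[k] (block y h (cover (2 ^ k) n r)) = block (tmInf^[k] y) (2 ^ k * h) r ++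
      (block (tmInf^[k] y) (2 ^ k * h + r) n ++ block (tmInf^[k] y) (2 ^ k * h + r + n) s) := by
    intro h
    rw [← block_tmInf_iterate, hs, block_add, block_add]
  have hl : block (tmInf^[k] y) (2 ^ k * h) r = block (tmInf^[k] y) (2 ^ k * h') r := by
    rw [block_eq_iff]
    exact fun i hi => tmInf_iterate_congr k y (hi.trans hr) (h1 (by omega))
  have hr : block (tmInf^[k] y) (2 ^ k * h + r + n) s =
      block (tmInf^[k] y) (2 ^ k * h' + r + n) s := by
    rw [block_eq_iff]
    intro i hi
    have e : ∀ h, 2 ^ k * h + r + n + i = 2 ^ k * (h + a) + (c + i) := fun h => by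
      rw [add_assoc (2 ^ k * h), hac]; ring
    have hc0 : c ≠ 0 := by
      rintro rfl
      rw [s3, if_pos rfl, add_zero] at hs
      omega
    rw [s3, if_neg hc0, mul_add] at hs
    rw [e, e]
    exact tmInf_iterate_congr k y (by omega) (h2 hc0)
  rw [hsplit, hsplit, hl, hr]
  exact ⟨fun h => (BEq.refl _).append (h.append (BEq.refl _)),
    fun h => h.of_append_left.of_append_right⟩

theorem SameCover.beq {k n : ℕ} {y : ℕ → Fin 2} {r h h' : ℕ} (hr : r < 2 ^ k)
    (hs : SameCover (2 ^ k) n y r h h') :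
    BEq (k + 1) (block (tmInf^[k] y) (2 ^ k * h + r) n)
      (block (tmInf^[k] y) (2 ^ k * h' + r) n) := by
  rw [beq_block_iff hr hs.2.1 hs.2.2]
  exact beq_tm_iterate k (by simp) (by rw [ones_block, ones_block, hs.1])

theorem SameCover.wtPos_eq {k n : ℕ} {y : ℕ → Fin 2} {r h h' : ℕ} (hr : r < 2 ^ k)
    (hs : SameCover (2 ^ k) n y r h h')
    (hb : BEq (k + 2) (block (tmInf^[k] y) (2 ^ k * h + r) n)
      (block (tmInf^[k] y) (2 ^ k * h' + r) n)) :
    wtPos y h (cover (2 ^ k) n r) = wtPos y h' (cover (2 ^ k) n r) := by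
  rw [beq_block_iff hr hs.2.1 hs.2.2] at hb
  rw [← onesPos_block, ← onesPos_block]
  exact onesPos_eq_of_beq k (by simp) (by rw [ones_block, ones_block, hs.1]) hb

theorem four_le_cover {N n r : ℕ} (hN : 0 < N) (hn : 4 * N ≤ n) : 4 ≤ cover N n r := by
  rw [cover, Nat.le_div_iff_mul_le hN]
  omega

/-- The parses of a block at the levels `φ` and `φᵏ` combine. -/
theorem SameCover.comp {N n : ℕ} {y : ℕ → Fin 2} {r e g g' : ℕ} (hN : 0 < N) (he : e < 2)
    (h1 : SameCover N n (tmInf y) r (2 * g + e) (2 * g' + e))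
    (h2 : SameCover 2 (cover N n r) y e g g') : SameCover (2 * N) n y (N * e + r) g g' := by
  obtain ⟨a, c, hc, hac⟩ := div_decomp hN (r + n)
  obtain ⟨s1, s2, s3⟩ := cover_mul_sub hN hc hac
  obtain ⟨b, d, hd, hbd⟩ := div_decomp (N := 2) (by norm_num) (e + a)
  have hc' : N * d + c < 2 * N := by
    have : N * d ≤ N * 1 := Nat.mul_le_mul_left N (by omega)
    omega
  have hac' : N * e + r + n = 2 * N * b + (N * d + c) := by
    rw [add_assoc, hac, ← add_assoc, ← mul_add, hbd]
    ring
  obtain ⟨t1, t2, t3⟩ := cover_mul_sub (by omega) hc' hac'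
  rw [SameCover, s1, s2] at h1
  rw [SameCover, t1, t2, t3]
  have hNd : N * d = 0 ↔ d = 0 := by simp; omega
  -- If the block ends on a boundary of level `N`, the last letter of `y` comes from the parse `h2`.
  -- Otherwise `h1` gives a last letter of `φ(y)`, which determines the letter of `y` that it comes
  -- from.
  by_cases hc0 : c = 0
  · rw [s3, if_pos hc0, add_zero] at h2
    obtain ⟨u1, u2, u3⟩ := cover_mul_sub (N := 2) (by norm_num) hd hbd
    rw [SameCover, u1, u2, u3] at h2
    simp only [hc0, add_zero, hNd]
    refine ⟨h2.1, fun h => ?_, h2.2.2⟩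
    by_cases he0 : e = 0
    · have := h1.2.1 (by rintro rfl; exact h (by simp [he0]))
      rwa [he0, add_zero, add_zero, tmInf_even, tmInf_even] at this
    · exact h2.2.1 he0
  · rw [s3, if_neg hc0] at h2
    have hlast : y (g + b) = y (g' + b) := by
      have := h1.2.2 hc0
      rw [show 2 * g + e + a = 2 * (g + b) + d by omega,
        show 2 * g' + e + a = 2 * (g' + b) + d by omega] at this
      obtain rfl | rfl : d = 0 ∨ d = 1 := by omega
      · rwa [add_zero, add_zero, tmInf_even, tmInf_even] at this
      · rwa [tmInf_odd, tmInf_odd, sub_right_inj] at this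
    have hcov : cover 2 (a + 1) e = b + 1 := by
      rw [cover]
      omega
    rw [SameCover, hcov] at h2
    have : N * d + c ≠ 0 := by omega
    rw [if_neg this]
    refine ⟨h2.1, fun h => ?_, fun _ => hlast⟩
    by_cases he0 : e = 0
    · have := h1.2.1 (by rintro rfl; exact h (by simp [he0]))
      rwa [he0, add_zero, add_zero, tmInf_even, tmInf_even] at this
    · exact h2.2.1 he0

/-- The binomial equivalence of factors of `φᵏ(v)` determines their parses. -/
theorem sameCover_of_beq (k : ℕ) {n : ℕ} {v : ℕ → Fin 2} (hv : CubeFree v) (hn : 2 * 2 ^ k ≤ n)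
    {r r' h h' : ℕ} (hr : r < 2 ^ k) (hr' : r' < 2 ^ k)
    (hb : BEq (k + 1) (block (tmInf^[k] v) (2 ^ k * h + r) n)
      (block (tmInf^[k] v) (2 ^ k * h' + r') n)) :
    r = r' ∧ SameCover (2 ^ k) n v r h h' := by
  induction k generalizing v r r' h h' with
  | zero =>
    obtain rfl : r = 0 := by omega
    obtain rfl : r' = 0 := by omega
    have := hb.ones_eq
    rw [ones_block, ones_block] at this
    simpa [SameCover, cover] using this
  | succ k ih =>
    have hN := Nat.two_pow_pos k
    rw [pow_succ'] at hn hr hr' hb ⊢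
    obtain ⟨e, r, hrr, rfl⟩ := div_decomp hN r
    obtain ⟨e', r', hrr', rfl⟩ := div_decomp hN r'
    have he : e < 2 := by
      by_contra hcon
      have := Nat.mul_le_mul_left (2 ^ k) (not_lt.1 hcon)
      omega
    have he' : e' < 2 := by
      by_contra hcon
      have := Nat.mul_le_mul_left (2 ^ k) (not_lt.1 hcon)
      omega
    rw [Function.iterate_succ_apply,
      show 2 * 2 ^ k * h + (2 ^ k * e + r) = 2 ^ k * (2 * h + e) + r by ring,
      show 2 * 2 ^ k * h' + (2 ^ k * e' + r') = 2 ^ k * (2 * h' + e') + r' by ring] at hb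
    -- Level `k + 1` parses the blocks over `φ(v)`, which is always cube-free. The extra level gives
    -- the position sums of the covers, and the dichotomy then parses these covers over `v`.
    obtain ⟨rfl, hs⟩ := ih (cubeFree_tmInf v) (by omega) hrr hrr' (hb.mono (by omega))
    have hp := hs.wtPos_eq hrr hb
    rcases wt_tmInf_dichotomy he he' (four_le_cover hN (by omega)) hs.1 hp with
      ⟨rfl, h3⟩ | ⟨_, h3⟩
    · exact ⟨rfl, hs.comp hN he h3⟩
    · exact absurd hv h3

/-- The classes of factors of `φᵏ(y)`, where `y` contains no cube of a letter. -/
theorem beq_iff_sameCover (k : ℕ) {n : ℕ} {y : ℕ → Fin 2} (hy : CubeFree y) (hn : 2 * 2 ^ k ≤ n)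
    {r r' h h' : ℕ} (hr : r < 2 ^ k) (hr' : r' < 2 ^ k) :
    BEq (k + 1) (block (tmInf^[k] y) (2 ^ k * h + r) n)
      (block (tmInf^[k] y) (2 ^ k * h' + r') n) ↔ r = r' ∧ SameCover (2 ^ k) n y r h h' := by
  refine ⟨sameCover_of_beq k hy hn hr hr', ?_⟩
  rintro ⟨rfl, hs⟩
  exact hs.beq hr

/-- The classes of factors of `φᵏ⁺¹(y)`, for any `y`. -/
theorem beq_tmInf_iff (k : ℕ) {n : ℕ} (y : ℕ → Fin 2) (hn : 4 * 2 ^ k ≤ n)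
    {r r' h h' : ℕ} (hr : r < 2 ^ k) (hr' : r' < 2 ^ k) :
    BEq (k + 2) (block (tmInf^[k] (tmInf y)) (2 ^ k * h + r) n)
      (block (tmInf^[k] (tmInf y)) (2 ^ k * h' + r') n) ↔
      r = r' ∧ SameCover (2 ^ k) n (tmInf y) r h h' ∧
        wtPos (tmInf y) h (cover (2 ^ k) n r) = wtPos (tmInf y) h' (cover (2 ^ k) n r) := by
  have hN := Nat.two_pow_pos k
  constructor
  · intro hb
    obtain ⟨rfl, hs⟩ :=
      sameCover_of_beq k (cubeFree_tmInf y) (by omega) hr hr' (hb.mono (by omega))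
    exact ⟨rfl, hs, hs.wtPos_eq hr hb⟩
  · rintro ⟨rfl, hs, hp⟩
    obtain ⟨g, e, he, rfl⟩ := div_decomp (N := 2) (by norm_num) h
    obtain ⟨g', e', he', rfl⟩ := div_decomp (N := 2) (by norm_num) h'
    rcases wt_tmInf_dichotomy he he' (four_le_cover hN hn) hs.1 hp with ⟨rfl, h3⟩ | ⟨h3, _⟩
    · have hc := hs.comp hN he h3
      have hlt : 2 ^ k * e + r < 2 * 2 ^ k := by
        have : 2 ^ k * e ≤ 2 ^ k * 1 := Nat.mul_le_mul_left _ (by omega)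
        omega
      rw [← pow_succ'] at hc hlt
      have := hc.beq hlt
      rwa [Function.iterate_succ_apply, pow_succ',
        show 2 * 2 ^ k * g + (2 ^ k * e + r) = 2 ^ k * (2 * g + e) + r by ring,
        show 2 * 2 ^ k * g' + (2 ^ k * e + r) = 2 ^ k * (2 * g' + e) + r by ring] at this
    -- Here the covers are equal words, so cubes in `y` do no harm.
    · rw [beq_block_iff hr hs.2.1 hs.2.2, h3]
      exact BEq.refl _

/-! ### Counting classes -/

theorem ncard_range_congr {ι α β : Type*} {f : ι → α} {g : ι → β}
    (h : ∀ i j, f i = f j ↔ g i = g j) : (Set.range f).ncard = (Set.range g).ncard := by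
  have hk : Setoid.ker f = Setoid.ker g := Setoid.ext fun i j => h i j
  exact Nat.card_congr ((Setoid.quotientKerEquivRange f).symm.trans
    ((Quotient.congrRight fun i j => h i j).trans (Setoid.quotientKerEquivRange g)))

theorem ncard_range_eq_sum_mod {α : Type*} {f : ℕ → α} {N : ℕ} (hN : 0 < N)
    (hf : (Set.range f).Finite) (h : ∀ q q', f q = f q' → q % N = q' % N) :
    (Set.range f).ncard = ∑ r ∈ Finset.range N, (Set.range fun h => f (N * h + r)).ncard := by
  classical
  have hfin : ∀ r, (Set.range fun h => f (N * h + r)).Finite := fun r =>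
    hf.subset (Set.range_subset_iff.2 fun h => ⟨_, rfl⟩)
  have hU : hf.toFinset = (Finset.range N).biUnion fun r => (hfin r).toFinset := by
    ext a
    simp only [Set.Finite.mem_toFinset, Finset.mem_biUnion, Set.mem_range, Finset.mem_range]
    constructor
    · rintro ⟨q, rfl⟩
      exact ⟨q % N, Nat.mod_lt _ hN, q / N, by rw [Nat.div_add_mod]⟩
    · rintro ⟨r, _, q, rfl⟩
      exact ⟨_, rfl⟩
  rw [Set.ncard_eq_toFinset_card _ hf, hU, Finset.card_biUnion]
  · exact Finset.sum_congr rfl fun r _ => (Set.ncard_eq_toFinset_card _ (hfin r)).symm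
  · intro r hr r' hr' hne
    rw [Finset.mem_coe, Finset.mem_range] at hr hr'
    change Disjoint (hfin r).toFinset (hfin r').toFinset
    rw [Finset.disjoint_left]
    simp only [Set.Finite.mem_toFinset, Set.mem_range]
    rintro _ ⟨q, rfl⟩ ⟨q', hq'⟩
    have := h _ _ hq'
    rw [Nat.mul_add_mod, Nat.mul_add_mod, Nat.mod_eq_of_lt hr, Nat.mod_eq_of_lt hr'] at this
    exact hne this.symm

/-- The class of the factor of length `n` of `x` at position `q`. -/
def blockClass (k : ℕ) (x : ℕ → Fin 2) (n q : ℕ) : Quotient (binomSetoid (Fin 2) k) :=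
  Quotient.mk _ (block x q n)

theorem blockClass_eq_iff {k : ℕ} {x : ℕ → Fin 2} {n q q' : ℕ} :
    blockClass k x n q = blockClass k x n q' ↔ BEq k (block x q n) (block x q' n) :=
  Quotient.eq

theorem binomComplexity_eq (k : ℕ) (x : ℕ → Fin 2) (n : ℕ) :
    binomComplexity k x n = (Set.range (blockClass k x n)).ncard := by
  rw [binomComplexity, factors, ← Set.range_comp]
  rfl

theorem finite_range_block {α : Type*} (x : ℕ → Fin 2) (n : ℕ) (F : (Fin n → Fin 2) → α)
    {f : ℕ → α} (hf : ∀ q, f q = F fun i => x (q + i)) : (Set.range f).Finite :=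
  (Set.finite_range F).subset (Set.range_subset_iff.2 fun q => ⟨_, (hf q).symm⟩)

theorem finite_range_blockClass (k : ℕ) (x : ℕ → Fin 2) (n : ℕ) :
    (Set.range (blockClass k x n)).Finite :=
  finite_range_block x n (fun u => Quotient.mk _ (List.ofFn u)) fun _ => rfl

/-- The first letter, the weight and the last letter of the factor of length `m + 1` of `y` at
position `h`. -/
def triple (y : ℕ → Fin 2) (m h : ℕ) : Fin 2 × ℕ × Fin 2 := (y h, wt y h (m + 1), y (h + m))

theorem binomComplexity_eq_sum {k n N : ℕ} {x : ℕ → Fin 2} {R : ℕ → ℕ → ℕ → Prop} (hN : 0 < N)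
    (h : ∀ {r r' h h' : ℕ}, r < N → r' < N → (BEq k (block x (N * h + r) n)
      (block x (N * h' + r') n) ↔ r = r' ∧ R r h h')) :
    binomComplexity k x n =
      ∑ r ∈ Finset.range N, (Set.range fun h => blockClass k x n (N * h + r)).ncard := by
  rw [binomComplexity_eq, ncard_range_eq_sum_mod hN (finite_range_blockClass k x n)]
  intro q q' hq
  rw [blockClass_eq_iff] at hq
  have e : ∀ q, q = N * (q / N) + q % N := fun q => (Nat.div_add_mod _ _).symm
  rw [e q, e q', h (Nat.mod_lt _ hN) (Nat.mod_lt _ hN)] at hq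
  exact hq.1

/-- At offset `0` no letter is cut and only the weight of `M` letters counts. At the other `2 ^ k -
1` offsets the cover has `M + 1` letters with both ends cut. -/
theorem binomComplexity_mul {k M : ℕ} {y : ℕ → Fin 2} (hy : CubeFree y) (hM : 2 ≤ M) :
    binomComplexity (k + 1) (tmInf^[k] y) (2 ^ k * M) =
      (Set.range fun h => wt y h M).ncard +
        (2 ^ k - 1) * (Set.range (triple y M)).ncard := by
  have hN := Nat.two_pow_pos k
  have hn : 2 * 2 ^ k ≤ 2 ^ k * M := by rw [mul_comm]; exact Nat.mul_le_mul_left _ hM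
  have key := fun {r r' h h' : ℕ} (hr : r < 2 ^ k) (hr' : r' < 2 ^ k) =>
    beq_iff_sameCover k hy hn (h := h) (h' := h') hr hr'
  rw [binomComplexity_eq_sum hN key]
  generalize hNe : 2 ^ k = N at *
  obtain ⟨N, rfl⟩ : ∃ p, N = p + 1 := ⟨N - 1, by omega⟩
  rw [Finset.sum_range_succ', add_comm, Nat.add_sub_cancel]
  congr 1
  · refine ncard_range_congr fun h h' => ?_
    obtain ⟨s1, s2, s3⟩ := cover_mul_sub (N := N + 1) (n := (N + 1) * M) (r := 0) (a := M) (c := 0)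
      hN hN (by ring)
    rw [blockClass_eq_iff, key hN hN, SameCover, s1, s2, s3]
    simp
  · rw [Finset.sum_congr rfl (g := fun _ => (Set.range (triple y M)).ncard)]
    · simp
    · intro r hr
      rw [Finset.mem_range] at hr
      refine ncard_range_congr fun h h' => ?_
      obtain ⟨s1, s2, s3⟩ := cover_mul_sub (N := N + 1) (n := (N + 1) * M) (r := r + 1) (a := M)
        (c := r + 1) hN (by omega) (by ring)
      rw [blockClass_eq_iff, key (by omega) (by omega), SameCover, s1, s2, s3]
      simp [triple]
      tauto

/-- At offset `0` only the last letter of the cover is cut, at the largest offset only the first,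
and at all others both. The two exceptional offsets provide the counts of pairs. -/
theorem binomComplexity_mul_add_one {k M : ℕ} {y : ℕ → Fin 2} (hy : CubeFree y) (hM : 2 ≤ M) :
    binomComplexity (k + 2) (tmInf^[k + 1] y) (2 ^ (k + 1) * M + 1) =
      (Set.range fun h => (triple y M h).2).ncard +
      (Set.range fun h => ((triple y M h).1, (triple y M h).2.1)).ncard +
        (2 ^ (k + 1) - 2) * (Set.range (triple y M)).ncard := by
  have hN := Nat.two_pow_pos (k + 1)
  have hn : 2 * 2 ^ (k + 1) ≤ 2 ^ (k + 1) * M + 1 := by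
    have := Nat.mul_le_mul_left (2 ^ (k + 1)) hM
    omega
  have key := fun {r r' h h' : ℕ} (hr : r < 2 ^ (k + 1)) (hr' : r' < 2 ^ (k + 1)) =>
    beq_iff_sameCover (k + 1) hy hn (h := h) (h' := h') hr hr'
  rw [binomComplexity_eq_sum hN key]
  have h2 : 2 ≤ 2 ^ (k + 1) := by rw [pow_succ]; have := Nat.two_pow_pos k; omega
  generalize hNe : 2 ^ (k + 1) = N at *
  obtain ⟨N, rfl⟩ : ∃ p, N = p + 2 := ⟨N - 2, by omega⟩
  rw [Finset.sum_range_succ', Finset.sum_range_succ, Nat.add_sub_cancel, add_comm, ← add_assoc,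
    add_right_comm]
  congr 1
  · congr 1
    · refine ncard_range_congr fun h h' => ?_
      obtain ⟨s1, s2, s3⟩ := cover_mul_sub (N := N + 2) (n := (N + 2) * M + 1) (r := 0) (a := M)
        (c := 1) hN (by omega) (by ring)
      rw [blockClass_eq_iff, key hN hN, SameCover, s1, s2, s3]
      simp [triple]
    · refine ncard_range_congr fun h h' => ?_
      obtain ⟨s1, s2, s3⟩ := cover_mul_sub (N := N + 2) (n := (N + 2) * M + 1) (r := N + 1)
        (a := M + 1) (c := 0) hN (by omega) (by ring)
      rw [blockClass_eq_iff, key (by omega) (by omega), SameCover, s1, s2, s3]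
      simp [triple]
      tauto
  · rw [Finset.sum_congr rfl (g := fun _ => (Set.range (triple y M)).ncard)]
    · simp
    · intro r hr
      rw [Finset.mem_range] at hr
      refine ncard_range_congr fun h h' => ?_
      obtain ⟨s1, s2, s3⟩ := cover_mul_sub (N := N + 2) (n := (N + 2) * M + 1) (r := r + 1) (a := M)
        (c := r + 2) hN (by omega) (by ring)
      rw [blockClass_eq_iff, key (by omega) (by omega), SameCover, s1, s2, s3]
      simp [triple]
      tauto

/-- Parsing over `φ(y)` instead of `y` keeps the count valid when `y` may contain cubes; the
position sums supply the missing level. -/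
theorem binomComplexity_four_mul (k : ℕ) (y : ℕ → Fin 2) :
    binomComplexity (k + 2) (tmInf^[k + 1] y) (4 * 2 ^ k) =
      (Set.range fun h => (wt (tmInf y) h 4, wtPos (tmInf y) h 4)).ncard +
        (2 ^ k - 1) * (Set.range fun h => (triple (tmInf y) 4 h, wtPos (tmInf y) h 5)).ncard := by
  have hN := Nat.two_pow_pos k
  have key := fun {r r' h h' : ℕ} (hr : r < 2 ^ k) (hr' : r' < 2 ^ k) =>
    beq_tmInf_iff k y le_rfl (h := h) (h' := h') hr hr'
  rw [Function.iterate_succ_apply, binomComplexity_eq_sum hN key]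
  generalize hNe : 2 ^ k = N at *
  obtain ⟨N, rfl⟩ : ∃ p, N = p + 1 := ⟨N - 1, by omega⟩
  rw [Finset.sum_range_succ', add_comm, Nat.add_sub_cancel]
  congr 1
  · refine ncard_range_congr fun h h' => ?_
    obtain ⟨s1, s2, s3⟩ := cover_mul_sub (N := N + 1) (n := 4 * (N + 1)) (r := 0) (a := 4) (c := 0)
      hN hN (by ring)
    rw [blockClass_eq_iff, key hN hN, SameCover, s1, s2, s3]
    simp
  · rw [Finset.sum_congr rfl (g := fun _ =>
      (Set.range fun h => (triple (tmInf y) 4 h, wtPos (tmInf y) h 5)).ncard)]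
    · simp
    · intro r hr
      rw [Finset.mem_range] at hr
      refine ncard_range_congr fun h h' => ?_
      obtain ⟨s1, s2, s3⟩ := cover_mul_sub (N := N + 1) (n := 4 * (N + 1)) (r := r + 1) (a := 4)
        (c := r + 1) hN (by omega) (by ring)
      rw [blockClass_eq_iff, key (by omega) (by omega), SameCover, s1, s2, s3]
      simp [triple]
      tauto

theorem binomComplexity_two_five (y : ℕ → Fin 2) :
    binomComplexity 2 (tmInf y) 5 =
      (Set.range fun h => (wt (tmInf y) h 5, wtPos (tmInf y) h 5)).ncard := by
  have key := fun {h h' : ℕ} =>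
    beq_tmInf_iff 0 (n := 5) y (by norm_num) (r := 0) (r' := 0) (h := h) (h' := h')
      (by norm_num) (by norm_num)
  simp only [pow_zero, one_mul, add_zero, Function.iterate_zero, id_eq, SameCover] at key
  rw [binomComplexity_eq]
  refine ncard_range_congr fun h h' => ?_
  rw [blockClass_eq_iff, key]
  simp [cover]

/-- The abelian complexity. -/
theorem binomComplexity_one (y : ℕ → Fin 2) (n : ℕ) :
    binomComplexity 1 y n = (Set.range fun h => wt y h n).ncard := by
  rw [binomComplexity_eq]
  refine ncard_range_congr fun h h' => ?_
  rw [blockClass_eq_iff]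
  constructor
  · intro hb
    have := hb.ones_eq
    rwa [ones_block, ones_block] at this
  · intro hw
    exact beq_tm_iterate 0 (u := block y h n) (v := block y h' n) (by simp)
      (by rw [ones_block, ones_block, hw])

/-! ### Cubes of letters -/

/-- The factors of length three of `y`. -/
noncomputable def words3 (y : ℕ → Fin 2) : Finset (Fin 2 × Fin 2 × Fin 2) :=
  (Set.toFinite (Set.range fun h => (y h, y (h + 1), y (h + 2)))).toFinset

theorem mem_words3 {y : ℕ → Fin 2} {τ : Fin 2 × Fin 2 × Fin 2} :
    τ ∈ words3 y ↔ ∃ h, (y h, y (h + 1), y (h + 2)) = τ := by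
  simp [words3]

/-- The values of a function of words of length five at the two words of length five that occur in
the image of a word of length three under the Thue–Morse morphism. -/
def imageFive {α : Type*} [DecidableEq α] (F : Fin 2 → Fin 2 → Fin 2 → Fin 2 → Fin 2 → α)
    (Y : Finset (Fin 2 × Fin 2 × Fin 2)) : Finset α :=
  Y.image (fun τ => F τ.1 (1 - τ.1) τ.2.1 (1 - τ.2.1) τ.2.2) ∪
    Y.image fun τ => F (1 - τ.1) τ.2.1 (1 - τ.2.1) τ.2.2 (1 - τ.2.2)

theorem ncard_range_five {α : Type*} [DecidableEq α]
    (F : Fin 2 → Fin 2 → Fin 2 → Fin 2 → Fin 2 → α) (y : ℕ → Fin 2) {f : ℕ → α}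
    (hf : ∀ h, f h = F (tmInf y h) (tmInf y (h + 1)) (tmInf y (h + 2)) (tmInf y (h + 3))
      (tmInf y (h + 4))) : (Set.range f).ncard = (imageFive F (words3 y)).card := by
  rw [← Set.ncard_coe_finset]
  have he : ∀ g, f (2 * g) = F (y g) (1 - y g) (y (g + 1)) (1 - y (g + 1)) (y (g + 2)) := by
    intro g
    rw [hf, show 2 * g + 2 = 2 * (g + 1) by ring, show 2 * g + 3 = 2 * (g + 1) + 1 by ring,
      show 2 * g + 4 = 2 * (g + 2) by ring]
    simp only [tmInf_even, tmInf_odd]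
  have ho : ∀ g, f (2 * g + 1) =
      F (1 - y g) (y (g + 1)) (1 - y (g + 1)) (y (g + 2)) (1 - y (g + 2)) := by
    intro g
    rw [hf, show 2 * g + 1 + 1 = 2 * (g + 1) by ring,
      show 2 * g + 1 + 2 = 2 * (g + 1) + 1 by ring, show 2 * g + 1 + 3 = 2 * (g + 2) by ring,
      show 2 * g + 1 + 4 = 2 * (g + 2) + 1 by ring]
    simp only [tmInf_even, tmInf_odd]
  congr 1
  ext a
  simp only [Set.mem_range, imageFive, Finset.coe_union, Finset.coe_image, Set.mem_union,
    Set.mem_image, Finset.mem_coe, mem_words3]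
  constructor
  · rintro ⟨h, rfl⟩
    obtain ⟨g, rfl | rfl⟩ := Nat.even_or_odd' h
    · exact Or.inl ⟨_, ⟨g, rfl⟩, (he g).symm⟩
    · exact Or.inr ⟨_, ⟨g, rfl⟩, (ho g).symm⟩
  · rintro (⟨_, ⟨g, rfl⟩, rfl⟩ | ⟨_, ⟨g, rfl⟩, rfl⟩)
    · exact ⟨_, he g⟩
    · exact ⟨_, ho g⟩

/-- The weight and the sum of the positions of the letters `1`, for the first four letters. -/
def dataFour (a b c d _e : Fin 2) : ℕ × ℕ :=
  (a.val + b.val + c.val + d.val, b.val + 2 * c.val + 3 * d.val)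

/-- The weight and the sum of the positions of the letters `1`. -/
def dataFive (a b c d e : Fin 2) : ℕ × ℕ :=
  (a.val + b.val + c.val + d.val + e.val, b.val + 2 * c.val + 3 * d.val + 4 * e.val)

/-- The weight, the sum of the positions of the letters `1`, the first and the last letter. -/
def dataFiveEnds (a b c d e : Fin 2) : (Fin 2 × ℕ × Fin 2) × ℕ :=
  ((a, (dataFive a b c d e).1, e), (dataFive a b c d e).2)

theorem wt_four (v : ℕ → Fin 2) (h : ℕ) : (wt v h 4, wtPos v h 4) =
    dataFour (v h) (v (h + 1)) (v (h + 2)) (v (h + 3)) (v (h + 4)) := by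
  simp [wt, wtPos, dataFour, Finset.sum_range_succ]

theorem wt_five (v : ℕ → Fin 2) (h : ℕ) : (wt v h 5, wtPos v h 5) =
    dataFive (v h) (v (h + 1)) (v (h + 2)) (v (h + 3)) (v (h + 4)) := by
  simp [wt, wtPos, dataFive, Finset.sum_range_succ]

theorem triple_four (v : ℕ → Fin 2) (h : ℕ) : (triple v 4 h, wtPos v h 5) =
    dataFiveEnds (v h) (v (h + 1)) (v (h + 2)) (v (h + 3)) (v (h + 4)) := by
  simp [triple, wt, wtPos, dataFive, dataFiveEnds, Finset.sum_range_succ]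

-- Exhaustive check over all sets of words of length three. The bounds `9`, `12` and `8` are the
-- values for `noCubes`, and each alternative contradicts equality of the complexities.
set_option maxRecDepth 10000 in
theorem card_imageFive_of_cube : ∀ Y : Finset (Fin 2 × Fin 2 × Fin 2), (∃ a, (a, a, a) ∈ Y) →
    ((imageFive dataFour Y).card = 9 ∧ 12 < (imageFive dataFiveEnds Y).card ∧
      (imageFive dataFive Y).card ≠ 8) ∨
    ((imageFive dataFour Y).card < 9 ∧ (imageFive dataFiveEnds Y).card ≤ 12) := by
  decide +kernel

/-- The words of length three that are not cubes of a letter. -/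
def noCubes : Finset (Fin 2 × Fin 2 × Fin 2) :=
  {(0, 0, 1), (0, 1, 0), (0, 1, 1), (1, 0, 0), (1, 0, 1), (1, 1, 0)}

theorem card_imageFive_noCubes : (imageFive dataFour noCubes).card = 9 ∧
    (imageFive dataFiveEnds noCubes).card = 12 ∧ (imageFive dataFive noCubes).card = 8 := by
  decide +kernel

theorem cubeFree_of_binomComplexity {k : ℕ} {y t : ℕ → Fin 2} (ht : words3 t = noCubes)
    (h : binomComplexity (k + 2) (tmInf^[k + 1] y) = binomComplexity (k + 2) (tmInf^[k + 1] t)) :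
    CubeFree y := by
  intro i h1 h2
  have hc : ∃ a, (a, a, a) ∈ words3 y := ⟨y i, mem_words3.2 ⟨i, by rw [← h2, ← h1]⟩⟩
  have e1 := congrFun h (4 * 2 ^ k)
  rw [binomComplexity_four_mul, binomComplexity_four_mul,
    ncard_range_five dataFour y (wt_four _), ncard_range_five dataFour t (wt_four _),
    ncard_range_five dataFiveEnds y (triple_four _),
    ncard_range_five dataFiveEnds t (triple_four _), ht, card_imageFive_noCubes.1,
    card_imageFive_noCubes.2.1] at e1
  rcases card_imageFive_of_cube _ hc with ⟨c1, c2, c3⟩ | ⟨c1, c2⟩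
  · rw [c1] at e1
    -- For `k = 0` the second count has coefficient zero, and length five is needed as well.
    rcases Nat.eq_zero_or_pos (2 ^ k - 1) with h0 | h0
    · have hk : k = 0 := by
        by_contra hk
        have := Nat.one_lt_two_pow hk
        omega
      subst hk
      have e2 := congrFun h 5
      simp only [zero_add, Function.iterate_one] at e2
      rw [binomComplexity_two_five, binomComplexity_two_five,
        ncard_range_five dataFive y (wt_five _), ncard_range_five dataFive t (wt_five _), ht,
        card_imageFive_noCubes.2.2] at e2
      exact c3 e2
    · have := Nat.mul_lt_mul_of_pos_left c2 h0
      omega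
  · have := Nat.mul_le_mul_left (2 ^ k - 1) c2
    omega

/-! ### The Thue–Morse word -/

theorem tmInf_thueMorse : tmInf thueMorse = thueMorse := thueMorse_fixed.2

theorem tmInf_iterate_thueMorse (k : ℕ) : tmInf^[k] thueMorse = thueMorse :=
  Function.iterate_fixed tmInf_thueMorse k

theorem thueMorse_even (h : ℕ) : thueMorse (2 * h) = thueMorse h := by
  conv_lhs => rw [← tmInf_thueMorse, tmInf_even]

theorem thueMorse_odd (h : ℕ) : thueMorse (2 * h + 1) = 1 - thueMorse h := by
  conv_lhs => rw [← tmInf_thueMorse, tmInf_odd]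

theorem cubeFree_thueMorse : CubeFree thueMorse := by
  rw [← tmInf_thueMorse]
  exact cubeFree_tmInf _

theorem thueMorse_values : thueMorse 0 = 0 ∧ thueMorse 1 = 1 ∧ thueMorse 2 = 1 ∧
    thueMorse 3 = 0 ∧ thueMorse 4 = 1 ∧ thueMorse 5 = 0 ∧ thueMorse 6 = 0 ∧ thueMorse 7 = 1 := by
  have h0 : thueMorse 0 = 0 := rfl
  have h1 : thueMorse 1 = 1 := (thueMorse_odd 0).trans (by rw [h0]; rfl)
  have h2 : thueMorse 2 = 1 := (thueMorse_even 1).trans h1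
  have h3 : thueMorse 3 = 0 := (thueMorse_odd 1).trans (by rw [h1]; rfl)
  exact ⟨h0, h1, h2, h3, (thueMorse_even 2).trans h2, (thueMorse_odd 2).trans (by rw [h2]; rfl),
    (thueMorse_even 3).trans h3, (thueMorse_odd 3).trans (by rw [h3]; rfl)⟩

theorem words3_thueMorse : words3 thueMorse = noCubes := by
  obtain ⟨h0, h1, h2, h3, h4, h5, h6, h7⟩ := thueMorse_values
  ext τ
  constructor
  · intro h
    obtain ⟨i, rfl⟩ := mem_words3.1 h
    have hc := cubeFree_thueMorse i
    revert hc
    generalize thueMorse i = a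
    generalize thueMorse (i + 1) = b
    generalize thueMorse (i + 2) = c
    revert a b c
    decide
  · intro h
    rw [mem_words3]
    simp only [noCubes, Finset.mem_insert, Finset.mem_singleton] at h
    rcases h with rfl | rfl | rfl | rfl | rfl | rfl
    · exact ⟨5, by rw [h5, h6, h7]⟩
    · exact ⟨3, by rw [h3, h4, h5]⟩
    · exact ⟨0, by rw [h0, h1, h2]⟩
    · exact ⟨4, by rw [h4, h5, h6]⟩
    · exact ⟨2, by rw [h2, h3, h4]⟩
    · exact ⟨1, by rw [h1, h2, h3]⟩

/-- All pairs of letters occur at all distances in the Thue–Morse word. -/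
theorem exists_thueMorse_pair {d : ℕ} (hd : 0 < d) (a b : Fin 2) :
    ∃ i, thueMorse i = a ∧ thueMorse (i + d) = b := by
  induction d using Nat.strong_induction_on generalizing a b with
  | _ d ih =>
    obtain ⟨m, rfl | rfl⟩ := Nat.even_or_odd' d
    · obtain ⟨i, h1, h2⟩ := ih m (by omega) (by omega) a b
      exact ⟨2 * i, by rw [thueMorse_even, h1],
        by rw [show 2 * i + 2 * m = 2 * (i + m) by ring, thueMorse_even, h2]⟩
    · rcases Nat.eq_zero_or_pos m with rfl | hm
      · obtain ⟨h0, h1, h2, h3, h4, h5, h6, h7⟩ := thueMorse_values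
        fin_cases a <;> fin_cases b
        exacts [⟨5, h5, h6⟩, ⟨0, h0, h1⟩, ⟨2, h2, h3⟩, ⟨1, h1, h2⟩]
      · obtain ⟨i, h1, h2⟩ := ih m (by omega) hm a (1 - b)
        exact ⟨2 * i, by rw [thueMorse_even, h1],
          by rw [show 2 * i + (2 * m + 1) = 2 * (i + m) + 1 by ring, thueMorse_odd, h2]; simp⟩

theorem wt_thueMorse (h m : ℕ) : wt thueMorse (2 * h) (2 * m) = m ∧
    wt thueMorse (2 * h) (2 * m + 1) = m + (thueMorse (h + m)).val ∧
    wt thueMorse (2 * h + 1) (2 * m + 1) + (thueMorse h).val = m + 1 ∧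
    wt thueMorse (2 * h + 1) (2 * (m + 1)) + (thueMorse h).val =
      m + 1 + (thueMorse (h + 1 + m)).val := by
  have h1 := wt_tmInf_even_even thueMorse h m
  have h2 := wt_tmInf_even_odd thueMorse h m
  have h3 := wt_tmInf_odd_odd thueMorse h m
  have h4 := wt_tmInf_odd_even thueMorse h m
  rw [tmInf_thueMorse] at h1 h2 h3 h4
  exact ⟨h1, h2, h3, h4⟩

/-- A factor of length `2p + 1` consists of `p` blocks of weight one and a single letter, the last
or the first according to the parity of its position. Conversely, `exists_thueMorse_pair` at
distance `p` prescribes both end letters. -/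
theorem range_triple_thueMorse_even {p : ℕ} (hp : 0 < p) :
    Set.range (triple thueMorse (2 * p)) =
      {τ | τ.2.1 = p + τ.2.2.val ∨ τ.2.1 = p + τ.1.val} := by
  ext ⟨a, w, b⟩
  simp only [Set.mem_range, Set.mem_ofPred_eq, triple, Prod.mk.injEq]
  constructor
  · rintro ⟨q, rfl, rfl, rfl⟩
    obtain ⟨h, rfl | rfl⟩ := Nat.even_or_odd' q
    · left
      rw [(wt_thueMorse h p).2.1, ← mul_add, thueMorse_even]
    · right
      have := (wt_thueMorse h p).2.2.1
      have := val_one_sub (thueMorse h)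
      rw [thueMorse_odd]
      omega
  · rintro (h | h)
    · obtain ⟨i, h1, h2⟩ := exists_thueMorse_pair hp a b
      exact ⟨2 * i, by rw [thueMorse_even, h1], by rw [(wt_thueMorse i p).2.1, h2, h],
        by rw [← mul_add, thueMorse_even, h2]⟩
    · obtain ⟨i, h1, h2⟩ := exists_thueMorse_pair hp (1 - a) (1 - b)
      refine ⟨2 * i + 1, by rw [thueMorse_odd, h1]; simp, ?_,
        by rw [show 2 * i + 1 + 2 * p = 2 * (i + p) + 1 by ring, thueMorse_odd, h2]; simp⟩
      have := (wt_thueMorse i p).2.2.1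
      have := val_one_sub a
      rw [h1] at *
      omega

theorem range_triple_thueMorse_odd {p : ℕ} (hp : 0 < p) :
    Set.range (triple thueMorse (2 * p + 1)) =
      {τ | τ.2.1 = p + 1 ∨ τ.2.1 = p + τ.1.val + τ.2.2.val} := by
  ext ⟨a, w, b⟩
  simp only [Set.mem_range, Set.mem_ofPred_eq, triple, Prod.mk.injEq]
  constructor
  · rintro ⟨q, rfl, rfl, rfl⟩
    obtain ⟨h, rfl | rfl⟩ := Nat.even_or_odd' q
    · left
      exact (wt_thueMorse h (p + 1)).1
    · right
      have := (wt_thueMorse h p).2.2.2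
      have := val_one_sub (thueMorse h)
      rw [thueMorse_odd, show 2 * h + 1 + (2 * p + 1) = 2 * (h + 1 + p) by ring, thueMorse_even,
        show 2 * p + 1 + 1 = 2 * (p + 1) by ring]
      omega
  · rintro (h | h)
    · obtain ⟨i, h1, h2⟩ := exists_thueMorse_pair hp a (1 - b)
      exact ⟨2 * i, by rw [thueMorse_even, h1], by rw [h]; exact (wt_thueMorse i (p + 1)).1,
        by rw [← add_assoc, ← mul_add, thueMorse_odd, h2]; simp⟩
    · obtain ⟨i, h1, h2⟩ := exists_thueMorse_pair (Nat.succ_pos p) (1 - a) b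
      rw [show i + p.succ = i + 1 + p by rw [Nat.succ_eq_add_one]; ring] at h2
      refine ⟨2 * i + 1, by rw [thueMorse_odd, h1]; simp, ?_,
        by rw [show 2 * i + 1 + (2 * p + 1) = 2 * (i + 1 + p) by ring, thueMorse_even, h2]⟩
      have := (wt_thueMorse i p).2.2.2
      have := val_one_sub a
      rw [h1, h2] at *
      rw [show 2 * p + 1 + 1 = 2 * (p + 1) by ring]
      omega

/-! ### Words with the same factor weights as the Thue–Morse word -/

theorem finite_range_triple (y : ℕ → Fin 2) (m : ℕ) : (Set.range (triple y m)).Finite :=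
  finite_range_block y (m + 1) (fun u => (u 0, ∑ i, (u i).val, u (Fin.last m))) fun q => by
    simp [triple, wt, Finset.sum_range]

theorem finite_range_wt (y : ℕ → Fin 2) (m : ℕ) : (Set.range fun h => wt y h m).Finite :=
  finite_range_block y m (fun u => ∑ i, (u i).val) fun q => by simp [wt, Finset.sum_range]

/-- The inclusions bound both counts in `binomComplexity_mul`, so equality of the totals forces
equality of the triples; their coefficient `2 ^ k - 1` is positive. -/
theorem range_triple_eq_of_subset {k M : ℕ} {y : ℕ → Fin 2} (hk : 0 < k) (hM : 2 ≤ M)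
    (hy : CubeFree y)
    (hc : binomComplexity (k + 1) (tmInf^[k] y) = binomComplexity (k + 1) (tmInf^[k] thueMorse))
    (h1 : (Set.range fun h => wt y h M) ⊆ Set.range fun h => wt thueMorse h M)
    (h2 : Set.range (triple y M) ⊆ Set.range (triple thueMorse M)) :
    Set.range (triple y M) = Set.range (triple thueMorse M) := by
  have e := congrFun hc (2 ^ k * M)
  rw [binomComplexity_mul hy hM, binomComplexity_mul cubeFree_thueMorse hM] at e
  have l1 := Set.ncard_le_ncard h1 (finite_range_wt _ _)
  refine Set.eq_of_subset_of_ncard_le h2 ?_ (finite_range_triple _ _)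
  by_contra hlt
  have hk' := Nat.one_lt_two_pow hk.ne'
  have := Nat.mul_lt_mul_of_pos_left (not_le.1 hlt) (show 0 < 2 ^ k - 1 by omega)
  omega

theorem range_triple_two {k : ℕ} {y : ℕ → Fin 2} (hk : 0 < k) (hy : CubeFree y)
    (hc : binomComplexity (k + 1) (tmInf^[k] y) = binomComplexity (k + 1) (tmInf^[k] thueMorse)) :
    Set.range (triple y 2) = Set.range (triple thueMorse 2) := by
  refine range_triple_eq_of_subset hk le_rfl hy hc ?_ ?_
  · rintro _ ⟨h, rfl⟩
    have := wt_le y h 2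
    obtain ⟨h0, h1, h2, h3, h4, h5, h6, h7⟩ := thueMorse_values
    simp only [Set.mem_range]
    generalize wt y h 2 = w at *
    interval_cases w
    · exact ⟨5, by simp [wt, Finset.sum_range_succ, h5, h6]⟩
    · exact ⟨0, by simp [wt, Finset.sum_range_succ, h0, h1]⟩
    · exact ⟨1, by simp [wt, Finset.sum_range_succ, h1, h2]⟩
  · have e := range_triple_thueMorse_even one_pos
    rw [mul_one] at e
    rw [e]
    rintro _ ⟨h, rfl⟩
    have := hy h
    simp only [triple, wt, Finset.sum_range_succ, Finset.sum_range_zero, Set.mem_ofPred_eq,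
      add_zero, zero_add]
    revert this
    generalize y h = a
    generalize y (h + 1) = b
    generalize y (h + 2) = c
    revert a b c
    decide

theorem wt_subset_of_triple {y : ℕ → Fin 2} {m : ℕ}
    (h : Set.range (triple y m) = Set.range (triple thueMorse m)) :
    (Set.range fun h => wt y h (m + 1)) ⊆ Set.range fun h => wt thueMorse h (m + 1) := by
  rintro _ ⟨q, rfl⟩
  obtain ⟨q', hq'⟩ := h.subset ⟨q, rfl⟩
  exact ⟨q', congrArg (fun τ => τ.2.1) hq'⟩

theorem ncard_wt_of_triple {y : ℕ → Fin 2} {m : ℕ}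
    (h : Set.range (triple y m) = Set.range (triple thueMorse m)) :
    (Set.range fun h => wt y h (m + 1)).ncard =
      (Set.range fun h => wt thueMorse h (m + 1)).ncard := by
  have e : ∀ y : ℕ → Fin 2, (Set.range fun h => wt y h (m + 1)) =
      (fun τ : Fin 2 × ℕ × Fin 2 => τ.2.1) '' Set.range (triple y m) := fun y => by
    rw [← Set.range_comp]; rfl
  rw [e, e, h]

/-- The inclusion is forced by the two factors of length `2p + 1` inside a factor of length `2p +
2`. -/
theorem range_triple_odd {k p : ℕ} {y : ℕ → Fin 2} (hk : 0 < k) (hp : 0 < p) (hy : CubeFree y)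
    (hc : binomComplexity (k + 1) (tmInf^[k] y) = binomComplexity (k + 1) (tmInf^[k] thueMorse))
    (h : Set.range (triple y (2 * p)) = Set.range (triple thueMorse (2 * p))) :
    Set.range (triple y (2 * p + 1)) = Set.range (triple thueMorse (2 * p + 1)) := by
  refine range_triple_eq_of_subset hk (by omega) hy hc (wt_subset_of_triple h) ?_
  rw [range_triple_thueMorse_even hp] at h
  rw [range_triple_thueMorse_odd hp]
  rintro _ ⟨q, rfl⟩
  have h1 := h.subset ⟨q, rfl⟩
  have h2 := h.subset ⟨q + 1, rfl⟩
  have e1 := wt_succ_left y q (2 * p + 1)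
  have e2 := wt_succ_right y q (2 * p + 1)
  simp only [triple, Set.mem_ofPred_eq] at h1 h2 ⊢
  have b1 := val_le_one (y q)
  have b2 := val_le_one (y (q + (2 * p + 1)))
  have b3 := val_le_one (y (q + 2 * p))
  have b4 := val_le_one (y (q + 1))
  rw [show q + 1 + 2 * p = q + (2 * p + 1) by ring] at h2
  omega

-- Cardinality six alone does not single out `noCubes`; the two projections, which come from the
-- lengths `2ᵏM + 1`, do.
set_option maxRecDepth 10000 in
theorem eq_noCubes_of_card : ∀ Z : Finset (Fin 2 × Fin 2 × Fin 2), Z.card = 6 →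
    (Z.image fun τ => (τ.1.val + τ.2.1.val + τ.2.2.val, τ.2.2)).card +
      (Z.image fun τ => (τ.1, τ.1.val + τ.2.1.val + τ.2.2.val)).card = 8 → Z = noCubes := by
  decide +kernel

theorem card_noCubes : noCubes.card = 6 ∧
    (noCubes.image fun τ => (τ.1.val + τ.2.1.val + τ.2.2.val, τ.2.2)).card +
      (noCubes.image fun τ => (τ.1, τ.1.val + τ.2.1.val + τ.2.2.val)).card = 8 := by
  decide

/-- The numbers of triples of first letter, weight and last letter, in terms of the weight of the
word without its first and last letters. -/
theorem exists_finset_of_triple {y : ℕ → Fin 2} {m p : ℕ}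
    (h : ∀ q, ∃ e : Fin 2, wt y q (m + 1) = p + ((y q).val + e.val + (y (q + m)).val)) :
    ∃ Z : Finset (Fin 2 × Fin 2 × Fin 2),
      Set.range (triple y m) = (fun τ : Fin 2 × Fin 2 × Fin 2 =>
        (τ.1, p + (τ.1.val + τ.2.1.val + τ.2.2.val), τ.2.2)) '' Z ∧
      (Set.range (triple y m)).ncard = Z.card ∧
      (Set.range fun h => (triple y m h).2).ncard =
        (Z.image fun τ => (τ.1.val + τ.2.1.val + τ.2.2.val, τ.2.2)).card ∧
      (Set.range fun h => ((triple y m h).1, (triple y m h).2.1)).ncard =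
        (Z.image fun τ => (τ.1, τ.1.val + τ.2.1.val + τ.2.2.val)).card := by
  classical
  choose e he using h
  let f : ℕ → Fin 2 × Fin 2 × Fin 2 := fun q => (y q, e q, y (q + m))
  refine ⟨(Set.toFinite (Set.range f)).toFinset, ?_, ?_, ?_, ?_⟩
  · rw [Set.Finite.coe_toFinset, ← Set.range_comp]
    congr 1
    funext q
    simp [triple, f, he]
  · rw [← Set.ncard_eq_toFinset_card]
    refine ncard_range_congr fun q q' => ?_
    simp only [triple, he, f, Prod.mk.injEq]
    constructor
    · rintro ⟨h1, h2, h3⟩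
      rw [h1, h3] at h2
      exact ⟨h1, Fin.ext (by omega), h3⟩
    · rintro ⟨h1, h2, h3⟩
      rw [h1, h2, h3]
      exact ⟨rfl, rfl, rfl⟩
  · rw [← Set.ncard_coe_finset, Finset.coe_image, Set.Finite.coe_toFinset, ← Set.range_comp]
    refine ncard_range_congr fun q q' => ?_
    simp [triple, he, f]
  · rw [← Set.ncard_coe_finset, Finset.coe_image, Set.Finite.coe_toFinset, ← Set.range_comp]
    refine ncard_range_congr fun q q' => ?_
    simp [triple, he, f]

/-- Removing both ends of a factor of length `2p + 3` leaves weight `p` or `p + 1`, so a triple is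
coded by three bits. Inclusion is not automatic here. The lengths `2ᵏ⁺¹M` and `2ᵏ⁺¹M + 1`, with `M =
2p + 2`, give the cardinalities that determine the set of codes. -/
theorem range_triple_even {k p : ℕ} {y : ℕ → Fin 2} (hp : 0 < p) (hy : CubeFree y)
    (hc : binomComplexity (k + 2) (tmInf^[k + 1] y) =
      binomComplexity (k + 2) (tmInf^[k + 1] thueMorse))
    (h : Set.range (triple y (2 * p + 1)) = Set.range (triple thueMorse (2 * p + 1))) :
    Set.range (triple y (2 * p + 2)) = Set.range (triple thueMorse (2 * p + 2)) := by
  have interior : ∀ y : ℕ → Fin 2,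
      Set.range (triple y (2 * p + 1)) = Set.range (triple thueMorse (2 * p + 1)) →
      ∀ q, ∃ e : Fin 2, wt y q (2 * p + 2 + 1) =
        p + ((y q).val + e.val + (y (q + (2 * p + 2))).val) := by
    intro y h q
    rw [range_triple_thueMorse_odd hp] at h
    have h1 := h.subset ⟨q, rfl⟩
    simp only [triple, Set.mem_ofPred_eq] at h1
    have e1 := wt_succ_left y q (2 * p + 1)
    have e2 := wt_succ_right y q (2 * p + 2)
    have b1 := val_le_one (y q)
    have b2 := val_le_one (y (q + (2 * p + 1)))
    have e3 := wt_succ_left y q (2 * p + 2)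
    have e4 : wt y (q + 1) (2 * p + 2) = _ := wt_succ_right y (q + 1) (2 * p + 1)
    rw [show q + 1 + (2 * p + 1) = q + (2 * p + 2) by ring] at e4
    refine ⟨⟨wt y (q + 1) (2 * p + 1) - p, by omega⟩, ?_⟩
    simp only
    omega
  obtain ⟨Z, z0, z1, z2, z3⟩ := exists_finset_of_triple (interior y h)
  obtain ⟨T, t0, t1, t2, t3⟩ := exists_finset_of_triple (interior thueMorse rfl)
  -- For `t` the condition on a code `(a, c, b)` is `a + c = 1` or `c + b = 1`: the three bits are
  -- not all equal.
  have hT : T = noCubes := by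
    have e := range_triple_thueMorse_even (p := p + 1) (by omega)
    rw [show 2 * (p + 1) = 2 * p + 2 by ring, t0] at e
    ext ⟨a, c, b⟩
    have : (a, c, b) ∈ T ↔ (p + (a.val + c.val + b.val) = p + 1 + b.val ∨
        p + (a.val + c.val + b.val) = p + 1 + a.val) := by
      have e' := Set.ext_iff.1 e (a, p + (a.val + c.val + b.val), b)
      simp only [Set.mem_ofPred_eq] at e'
      rw [← e']
      simp only [Set.mem_image, Finset.mem_coe, Prod.mk.injEq, Prod.exists]
      constructor
      · exact fun h => ⟨a, c, b, h, rfl, rfl, rfl⟩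
      · rintro ⟨a', c', b', h, rfl, h', rfl⟩
        rwa [show c = c' from Fin.ext (by omega)]
    rw [this, add_assoc p 1, add_assoc p 1, add_right_inj, add_right_inj]
    clear this
    revert a b c
    decide
  subst hT
  have c1 := congrFun hc (2 ^ (k + 1) * (2 * p + 2))
  rw [binomComplexity_mul hy (by omega), binomComplexity_mul cubeFree_thueMorse (by omega),
    ncard_wt_of_triple h, add_right_inj, z1, t1] at c1
  have hN : 2 ≤ 2 ^ (k + 1) := by
    rw [pow_succ]
    have := Nat.two_pow_pos k
    omega
  have hcard := Nat.eq_of_mul_eq_mul_left (by omega) c1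
  have c2 := congrFun hc (2 ^ (k + 1) * (2 * p + 2) + 1)
  rw [binomComplexity_mul_add_one hy (by omega),
    binomComplexity_mul_add_one cubeFree_thueMorse (by omega), z1, z2, z3, t1, t2, t3, hcard,
    add_left_inj, card_noCubes.2] at c2
  rw [z0, t0, eq_noCubes_of_card Z (hcard.trans card_noCubes.1) c2]

theorem range_triple_eq {k : ℕ} {y : ℕ → Fin 2} (hy : CubeFree y)
    (hc : binomComplexity (k + 2) (tmInf^[k + 1] y) =
      binomComplexity (k + 2) (tmInf^[k + 1] thueMorse)) (p : ℕ) :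
    Set.range (triple y (2 * (p + 1))) = Set.range (triple thueMorse (2 * (p + 1))) := by
  induction p with
  | zero => exact range_triple_two (Nat.succ_pos k) hy hc
  | succ p ih =>
    exact range_triple_even (Nat.succ_pos p) hy hc
      (range_triple_odd (Nat.succ_pos k) (Nat.succ_pos p) hy hc ih)

/-- The factors of odd length of `y` have almost as many letters `0` as letters `1`. -/
def OddBalanced (y : ℕ → Fin 2) : Prop :=
  ∀ p h, wt y h (2 * p + 1) = p ∨ wt y h (2 * p + 1) = p + 1

theorem oddBalanced_of_binomComplexity {k : ℕ} {y : ℕ → Fin 2}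
    (hc : binomComplexity (k + 2) (tmInf^[k + 1] y) =
      binomComplexity (k + 2) (tmInf^[k + 1] thueMorse)) :
    OddBalanced y ∧ ∃ i, y i = y (i + 1) := by
  have hy := cubeFree_of_binomComplexity words3_thueMorse hc
  constructor
  · intro p h
    cases p with
    | zero =>
      have := val_le_one (y h)
      rw [mul_zero, zero_add, wt_one]
      omega
    | succ p =>
      have hr := range_triple_eq hy hc p
      rw [range_triple_thueMorse_even (Nat.succ_pos p)] at hr
      have := hr.subset ⟨h, rfl⟩
      simp only [triple, Set.mem_ofPred_eq] at this
      have b1 := val_le_one (y h)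
      have b2 := val_le_one (y (h + 2 * (p + 1)))
      omega
  · have hr := range_triple_eq hy hc 0
    rw [range_triple_thueMorse_even (Nat.succ_pos 0)] at hr
    -- This triple is the word `011`, which contains a square.
    obtain ⟨h, hh⟩ := hr.symm.subset (show ((0 : Fin 2), 1 + (1 : Fin 2).val, (1 : Fin 2)) ∈ _ from
      Or.inl rfl)
    simp only [triple, Prod.mk.injEq, wt, Finset.sum_range_succ, Finset.sum_range_zero] at hh
    obtain ⟨h1, h2, h3⟩ := hh
    refine ⟨h + 1, Fin.ext ?_⟩
    have e : y (h + 1 + 1) = 1 := h3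
    simp [h1, e] at h2 ⊢
    omega

/-! ### The abelian complexity -/

/-- Discrete intermediate value theorem, applied to the weight of a sliding window. -/
theorem exists_eq_of_step {f : ℕ → ℕ} (hf : ∀ i, f (i + 1) ≤ f i + 1 ∧ f i ≤ f (i + 1) + 1)
    {a b c : ℕ} (ha : f a ≤ c) (hb : c ≤ f b) : ∃ i, f i = c := by
  have key : ∀ d a, (f a ≤ c → c ≤ f (a + d) → ∃ i, f i = c) ∧
      (c ≤ f a → f (a + d) ≤ c → ∃ i, f i = c) := by
    intro d
    induction d with
    | zero => exact fun a => ⟨fun h h' => ⟨a, le_antisymm h h'⟩, fun h h' => ⟨a, le_antisymm h' h⟩⟩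
    | succ d ih =>
      intro a
      have h1 := hf a
      have e : a + (d + 1) = a + 1 + d := by ring
      rw [e]
      refine ⟨fun h h' => ?_, fun h h' => ?_⟩
      · by_cases h2 : f (a + 1) ≤ c
        · exact (ih (a + 1)).1 h2 h'
        · exact ⟨a, by omega⟩
      · by_cases h2 : c ≤ f (a + 1)
        · exact (ih (a + 1)).2 h2 h'
        · exact ⟨a, by omega⟩
  rcases le_total a b with h | h
  · obtain ⟨d, rfl⟩ := Nat.exists_eq_add_of_le h
    exact (key d a).1 ha hb
  · obtain ⟨d, rfl⟩ := Nat.exists_eq_add_of_le h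
    exact (key d b).2 hb ha

theorem wt_step (y : ℕ → Fin 2) (n h : ℕ) :
    wt y (h + 1) n ≤ wt y h n + 1 ∧ wt y h n ≤ wt y (h + 1) n + 1 := by
  have h1 := wt_succ_left y h n
  have h2 := wt_succ_right y h n
  have b1 := val_le_one (y h)
  have b2 := val_le_one (y (h + n))
  omega

theorem range_wt_thueMorse_even (p : ℕ) :
    (Set.range fun h => wt thueMorse h (2 * (p + 1))) = Finset.Icc p (p + 2) := by
  ext w
  simp only [Set.mem_range, Finset.coe_Icc, Set.mem_Icc]
  constructor
  · rintro ⟨q, rfl⟩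
    obtain ⟨h, rfl | rfl⟩ := Nat.even_or_odd' q
    · rw [(wt_thueMorse h (p + 1)).1]
      omega
    · have := (wt_thueMorse h p).2.2.2
      have b1 := val_le_one (thueMorse h)
      have b2 := val_le_one (thueMorse (h + 1 + p))
      omega
  · rintro ⟨h1, h2⟩
    have key : ∀ a b : Fin 2, ∃ q, wt thueMorse q (2 * (p + 1)) + a.val = p + 1 + b.val := by
      intro a b
      obtain ⟨i, h1, h2⟩ := exists_thueMorse_pair (Nat.succ_pos p) a b
      rw [show i + p.succ = i + 1 + p by rw [Nat.succ_eq_add_one]; ring] at h2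
      refine ⟨2 * i + 1, ?_⟩
      rw [← h1, ← h2]
      exact (wt_thueMorse i p).2.2.2
    obtain rfl | rfl | rfl : w = p ∨ w = p + 1 ∨ w = p + 2 := by omega
    · obtain ⟨q, hq⟩ := key 1 0
      exact ⟨q, by simpa using hq⟩
    · obtain ⟨q, hq⟩ := key 0 0
      exact ⟨q, by simpa using hq⟩
    · obtain ⟨q, hq⟩ := key 0 1
      exact ⟨q, by simpa using hq⟩

theorem range_wt_thueMorse_odd (p : ℕ) :
    (Set.range fun h => wt thueMorse h (2 * p + 1)) = Finset.Icc p (p + 1) := by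
  ext w
  simp only [Set.mem_range, Finset.coe_Icc, Set.mem_Icc]
  constructor
  · rintro ⟨q, rfl⟩
    obtain ⟨h, rfl | rfl⟩ := Nat.even_or_odd' q
    · have b1 := val_le_one (thueMorse (h + p))
      rw [(wt_thueMorse h p).2.1]
      omega
    · have := (wt_thueMorse h p).2.2.1
      have b1 := val_le_one (thueMorse h)
      omega
  · rintro ⟨h1, h2⟩
    have v0 := thueMorse_values.1
    have v1 := thueMorse_values.2.1
    obtain rfl | rfl : w = p ∨ w = p + 1 := by omega
    · refine ⟨2 * 1 + 1, ?_⟩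
      have := (wt_thueMorse 1 w).2.2.1
      rw [v1] at this
      simpa using this
    · refine ⟨2 * 0 + 1, ?_⟩
      have := (wt_thueMorse 0 p).2.2.1
      rw [v0] at this
      simpa using this

theorem oddBalanced_of_binomComplexity_one {y : ℕ → Fin 2}
    (hc : binomComplexity 1 y = binomComplexity 1 thueMorse) :
    OddBalanced y ∧ ∃ i, y i = y (i + 1) := by
  have hn : ∀ n, (Set.range fun h => wt y h n).ncard =
      (Set.range fun h => wt thueMorse h n).ncard := fun n => by
    rw [← binomComplexity_one, ← binomComplexity_one, hc]
  have even_of_subset : ∀ p, (∀ h, p ≤ wt y h (2 * (p + 1)) ∧ wt y h (2 * (p + 1)) ≤ p + 2) →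
      (Set.range fun h => wt y h (2 * (p + 1))) = Finset.Icc p (p + 2) := by
    intro p h
    refine Set.eq_of_subset_of_ncard_le ?_ ?_ (Finset.finite_toSet _)
    · rintro _ ⟨q, rfl⟩
      simpa using h q
    · rw [hn, range_wt_thueMorse_even]
  -- Extending factors of weights `p` and `p + 2` by a letter gives weights at most `p + 1` and at
  -- least `p + 2`. A sliding window attains both of these values, and the complexity allows only
  -- two.
  have odd_of_even : ∀ p, (Set.range fun h => wt y h (2 * (p + 1))) = Finset.Icc p (p + 2) →
      ∀ h, wt y h (2 * (p + 1) + 1) = p + 1 ∨ wt y h (2 * (p + 1) + 1) = p + 2 := by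
    intro p h
    obtain ⟨a, ha⟩ := h.symm.subset (show p ∈ _ by simp)
    obtain ⟨b, hb⟩ := h.symm.subset (show p + 2 ∈ _ by simp)
    simp only at ha hb
    have ea := wt_succ_right y a (2 * (p + 1))
    have eb := wt_succ_right y b (2 * (p + 1))
    have b1 := val_le_one (y (a + 2 * (p + 1)))
    obtain ⟨c, hc1⟩ := exists_eq_of_step (f := fun h => wt y h (2 * (p + 1) + 1))
      (wt_step y _) (a := a) (b := b) (c := p + 1) (by omega) (by omega)
    obtain ⟨d, hd1⟩ := exists_eq_of_step (f := fun h => wt y h (2 * (p + 1) + 1))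
      (wt_step y _) (a := a) (b := b) (c := p + 2) (by omega) (by omega)
    have hs : (Finset.Icc (p + 1) (p + 1 + 1) : Set ℕ) =
        Set.range fun h => wt y h (2 * (p + 1) + 1) := by
      refine Set.eq_of_subset_of_ncard_le ?_ ?_ (finite_range_wt _ _)
      · intro w hw
        simp only [Finset.coe_Icc, Set.mem_Icc] at hw
        obtain rfl | rfl : w = p + 1 ∨ w = p + 2 := by omega
        exacts [⟨c, hc1⟩, ⟨d, hd1⟩]
      · rw [hn, range_wt_thueMorse_odd]
    intro q
    have := hs.symm.subset ⟨q, rfl⟩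
    simp only [Finset.coe_Icc, Set.mem_Icc] at this
    omega
  have heven : ∀ p, (Set.range fun h => wt y h (2 * (p + 1))) = Finset.Icc p (p + 2) := by
    intro p
    induction p with
    | zero => exact even_of_subset 0 fun h => ⟨Nat.zero_le _, wt_le y h 2⟩
    | succ p ih =>
      refine even_of_subset (p + 1) fun h => ?_
      have h1 := odd_of_even p ih h
      have h2 := wt_succ_right y h (2 * (p + 1) + 1)
      have b1 := val_le_one (y (h + (2 * (p + 1) + 1)))
      rw [show 2 * (p + 1 + 1) = 2 * (p + 1) + 1 + 1 by ring]
      omega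
  constructor
  · intro p h
    cases p with
    | zero =>
      have := val_le_one (y h)
      rw [mul_zero, zero_add, wt_one]
      omega
    | succ p => exact odd_of_even p (heven p) h
  · obtain ⟨a, ha⟩ := (heven 0).symm.subset (show 0 ∈ _ by simp)
    refine ⟨a, ?_⟩
    rw [← add_zero a, eq_zero_of_wt_eq_zero ha (by norm_num), add_zero,
      eq_zero_of_wt_eq_zero ha (by norm_num)]

/-! ### Desubstitution -/

/-- Let `W` be the weight of prefixes. By `hlink`, every value of `W (2b + 1) - b` exceeds every
value of `W (2a) - a` by `0` or `1`, so one of these two sequences is constant. If it is the first,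
the blocks `01`, `10` start at odd positions; if the second, at even ones. -/
theorem exists_tmInf_of_oddBalanced {y : ℕ → Fin 2} (hy : OddBalanced y) :
    ∃ (z : ℕ → Fin 2) (p : ℕ), p < 2 ∧ ∀ i, y i = tmInf z (i + p) := by
  have hadd : ∀ a b, wt y 0 (a + b) = wt y 0 a + wt y a b := by
    intro a b
    induction b with
    | zero => rfl
    | succ b ih => rw [← add_assoc, wt_succ_right, ih, wt_succ_right, zero_add, add_assoc]
  have hlink : ∀ a b : ℕ, wt y 0 (2 * b + 1) + a = wt y 0 (2 * a) + b ∨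
      wt y 0 (2 * b + 1) + a = wt y 0 (2 * a) + b + 1 := by
    intro a b
    rcases le_or_gt a b with h | h
    · obtain ⟨d, rfl⟩ := Nat.exists_eq_add_of_le h
      have e := hadd (2 * a) (2 * d + 1)
      rw [show 2 * a + (2 * d + 1) = 2 * (a + d) + 1 by ring] at e
      rcases hy d (2 * a) with h1 | h1 <;> omega
    · obtain ⟨d, rfl⟩ := Nat.exists_eq_add_of_le (Nat.succ_le_of_lt h)
      have e := hadd (2 * b + 1) (2 * d + 1)
      rw [show 2 * b + 1 + (2 * d + 1) = 2 * (b.succ + d) by rw [Nat.succ_eq_add_one]; ring] at e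
      rcases hy d (2 * b + 1) with h1 | h1 <;> omega
  have hpair : ∀ {a b : Fin 2}, a.val + b.val = 1 → b = 1 - a := by decide
  by_cases hc : ∀ b, wt y 0 (2 * b + 1) = wt y 0 1 + b
  · refine ⟨fun i => 1 - y (2 * i), 1, by norm_num, fun i => ?_⟩
    obtain ⟨m, rfl | rfl⟩ := Nat.even_or_odd' i
    · rw [tmInf_odd]
      simp
    · rw [show 2 * m + 1 + 1 = 2 * (m + 1) by ring, tmInf_even]
      have e := wt_succ_right y 0 (2 * m + 1)
      have e' := wt_succ_right y 0 (2 * m + 1 + 1)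
      rw [show 2 * m + 1 + 1 + 1 = 2 * (m + 1) + 1 by ring, hc (m + 1)] at e'
      rw [hc m] at e
      rw [zero_add, show 2 * m + 1 + 1 = 2 * (m + 1) by ring] at e'
      rw [zero_add, show 2 * m + 1 + 1 = 2 * (m + 1) by ring] at e
      exact hpair (by omega)
  · push Not at hc
    obtain ⟨b, hb⟩ := hc
    have he : ∀ a, wt y 0 (2 * a) = a := by
      intro a
      have h1 := hlink 0 0
      have h2 := hlink 0 b
      have h3 := hlink a 0
      have h4 := hlink a b
      simp only [mul_zero, zero_add, wt_zero] at h1 h2 h3 h4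
      omega
    refine ⟨fun i => y (2 * i), 0, by norm_num, fun i => ?_⟩
    rw [add_zero]
    obtain ⟨m, rfl | rfl⟩ := Nat.even_or_odd' i
    · rw [tmInf_even]
    · rw [tmInf_odd]
      have e := wt_succ_right y 0 (2 * m)
      have e' := wt_succ_right y 0 (2 * m + 1)
      rw [show 2 * m + 1 + 1 = 2 * (m + 1) by ring, he, zero_add] at e'
      rw [he, zero_add] at e
      exact hpair (by omega)

/-! ### Recurrence and the induction on the level -/

/-- Every prefix of `y` occurs again. -/
def PrefixRecurrent {α : Type*} (y : ℕ → α) : Prop :=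
  ∀ l, ∃ g, 0 < g ∧ ∀ m < l, y (g + m) = y m

theorem Recurrent.prefixRecurrent {α : Type*} {x : ℕ → α} (h : Recurrent x) :
    PrefixRecurrent x := by
  intro l
  obtain ⟨g, hg, hpos⟩ := (h l (block x 0 l) ⟨0, rfl⟩).exists_gt 0
  refine ⟨g, hpos, fun m hm => ?_⟩
  simpa using (block_eq_iff x g 0 l).1 hg m hm

theorem odd_of_tmInf_eq {z : ℕ → Fin 2} {i : ℕ} (h : tmInf z i = tmInf z (i + 1)) :
    i % 2 = 1 := by
  obtain ⟨m, rfl | rfl⟩ := Nat.even_or_odd' i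
  · have := val_tmInf_odd z m
    rw [← h, tmInf_even] at this
    omega
  · omega

/-- A square of a letter in `φ(z)` straddles two blocks, so a return of a prefix containing it has
an even shift and descends to `z`. -/
theorem PrefixRecurrent.of_tmInf {y z : ℕ → Fin 2} {p : ℕ} (hy : PrefixRecurrent y) (hp : p < 2)
    (hz : ∀ i, y i = tmInf z (i + p)) (heq : ∃ i, y i = y (i + 1)) : PrefixRecurrent z := by
  obtain ⟨i, hi⟩ := heq
  intro l
  obtain ⟨g, hg, hgm⟩ := hy (2 * l + i + 2)
  have h1 : (i + p) % 2 = 1 := odd_of_tmInf_eq (z := z) (by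
    rw [← hz, hi, hz, add_right_comm])
  have h2 : (g + i + p) % 2 = 1 := odd_of_tmInf_eq (z := z) (by
    rw [← hz, hgm i (by omega), hi, ← hgm (i + 1) (by omega), hz]
    congr 1
    ring)
  obtain ⟨d, rfl⟩ : ∃ d, g = 2 * d := ⟨g / 2, by omega⟩
  refine ⟨d, by omega, fun m hm => ?_⟩
  -- Second halves of blocks are compared, because for `p = 1` the first half of the first block is
  -- missing from `y`.
  have h3 := hgm (2 * m + 1 - p) (by omega)
  rw [hz, hz, show 2 * d + (2 * m + 1 - p) + p = 2 * (d + m) + 1 by omega,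
    show 2 * m + 1 - p + p = 2 * m + 1 by omega, tmInf_odd, tmInf_odd, sub_right_inj] at h3
  exact h3

theorem tmInf_congr_add {y y' : ℕ → Fin 2} {g l : ℕ} (h : ∀ m < l, y (g + m) = y' m) {m : ℕ}
    (hm : m < 2 * l) : tmInf y (2 * g + m) = tmInf y' m := by
  rw [← tmInf_shift, tmInf, tmInf, h _ (by omega)]

theorem tmInf_iterate_congr_add (k : ℕ) {y y' : ℕ → Fin 2} {g l : ℕ}
    (h : ∀ m < l, y (g + m) = y' m) {m : ℕ} (hm : m < 2 ^ k * l) :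
    tmInf^[k] y (2 ^ k * g + m) = tmInf^[k] y' m := by
  induction k generalizing m with
  | zero => simpa using h m (by simpa using hm)
  | succ k ih =>
    rw [Function.iterate_succ_apply', Function.iterate_succ_apply', pow_succ', mul_assoc]
    rw [pow_succ', mul_assoc] at hm
    exact tmInf_congr_add (l := 2 ^ k * l) (fun m hm => ih hm) hm

/-- A factor near the start of `φᵏ(y)` reoccurs `2 ^ k * g ≥ 2 ^ k > q` positions later, where the
missing `q` letters no longer matter. -/
theorem factors_shift {k q n : ℕ} {x y : ℕ → Fin 2} (hy : PrefixRecurrent y) (hq : q < 2 ^ k)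
    (hx : ∀ i, x i = tmInf^[k] y (i + q)) : factors x n = factors (tmInf^[k] y) n := by
  have hb : ∀ i, block x i n = block (tmInf^[k] y) (i + q) n := by
    intro i
    simp only [block, hx]
    congr 1
    funext j
    exact congrArg _ (by ring)
  ext w
  constructor
  · rintro ⟨i, rfl⟩
    exact ⟨i + q, (hb i).symm⟩
  · rintro ⟨i, rfl⟩
    obtain ⟨g, hg, hgm⟩ := hy (i + n)
    have h1 : 2 ^ k ≤ 2 ^ k * g := Nat.le_mul_of_pos_right _ hg
    refine ⟨2 ^ k * g + i - q, ?_⟩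
    simp only
    rw [hb, show 2 ^ k * g + i - q + q = 2 ^ k * g + i by omega, block, block]
    congr 1
    funext j
    rw [add_assoc]
    refine tmInf_iterate_congr_add k hgm ?_
    have := j.isLt
    have h2 : i + n ≤ 2 ^ k * (i + n) := Nat.le_mul_of_pos_left _ (Nat.two_pow_pos k)
    omega

theorem exists_tmInf_iterate_of_tmProp (k : ℕ) {x : ℕ → Fin 2} (hrec : Recurrent x)
    (hx : TMProp k x) : ∃ (y : ℕ → Fin 2) (q : ℕ), PrefixRecurrent y ∧ q < 2 ^ k ∧
      ∀ i, x i = tmInf^[k] y (i + q) := by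
  induction k with
  | zero => exact ⟨x, 0, hrec.prefixRecurrent, by norm_num, fun i => rfl⟩
  | succ k ih =>
    obtain ⟨y, q, hy, hq, hxy⟩ := ih fun j h1 h2 => hx j h1 (by omega)
    have hc : binomComplexity (k + 1) (tmInf^[k] y) =
        binomComplexity (k + 1) (tmInf^[k] thueMorse) := by
      rw [tmInf_iterate_thueMorse, ← hx (k + 1) (by omega) le_rfl]
      funext n
      rw [binomComplexity, binomComplexity, factors_shift hy hq hxy]
    have hodd : OddBalanced y ∧ ∃ i, y i = y (i + 1) := by
      cases k with
      | zero => exact oddBalanced_of_binomComplexity_one hc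
      | succ k => exact oddBalanced_of_binomComplexity hc
    obtain ⟨z, p, hp, hz⟩ := exists_tmInf_of_oddBalanced hodd.1
    refine ⟨z, q + 2 ^ k * p, hy.of_tmInf hp hz hodd.2, ?_, fun i => ?_⟩
    · have := Nat.mul_le_mul_left (2 ^ k) (Nat.le_of_lt_succ hp)
      rw [pow_succ]
      omega
    · rw [hxy, Function.iterate_succ_apply, show i + (q + 2 ^ k * p) = 2 ^ k * p + (i + q) by ring]
      refine (tmInf_iterate_congr_add k (l := i + q + 1) (fun m _ => ?_) ?_).symm
      · rw [hz, add_comm]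
      · exact lt_of_lt_of_le (Nat.lt_succ_self _) (Nat.le_mul_of_pos_left _ (Nat.two_pow_pos k))

end BinomialWords

open BinomialWords
theorem mainTheorem4 (k : ℕ) (hk : 1 ≤ k) (x : ℕ → Fin 2) (hrec : Recurrent x)
    (hx : TMProp k x) :
    ∃ (y : ℕ → Fin 2) (u : List (Fin 2)) (a : Fin 2),
      u <:+ tm^[k] [a] ∧ u ≠ tm^[k] [a] ∧ x = concat u (tmInf^[k] y) := by
  obtain ⟨y, q, -, hq, hxy⟩ := exists_tmInf_iterate_of_tmProp k hrec hx
  rcases Nat.eq_zero_or_pos q with rfl | hq0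
  · refine ⟨y, [], 0, List.nil_suffix, fun h => ?_, ?_⟩
    · have := congrArg List.length h
      rw [length_tm_iterate_eq] at this
      exact (Nat.two_pow_pos k).ne (by simpa using this)
    · funext i
      simp [concat, hxy]
  · have hb : block (tmInf^[k] y) 0 (q + (2 ^ k - q)) = tm^[k] [y 0] := by
      have := block_tmInf_iterate k y 0 1
      rw [mul_zero, mul_one] at this
      rw [show q + (2 ^ k - q) = 2 ^ k by omega, this]
      rfl
    -- The first block `φᵏ(y 0)` loses its first `q` letters: what remains is `u`, and the later
    -- letters of `y` form the new word.
    refine ⟨fun i => y (1 + i), block (tmInf^[k] y) q (2 ^ k - q), y 0, ?_, fun h => ?_, ?_⟩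
    · rw [← hb, block_add, zero_add]
      exact List.suffix_append _ _
    · have := congrArg List.length h
      rw [length_tm_iterate_eq, length_block, List.length_singleton] at this
      omega
    · funext i
      rw [hxy, concat]
      split_ifs with h
      · simp [block, add_comm]
      · rw [length_block] at h ⊢
        rw [← tmInf_iterate_congr_add k (y := y) (g := 1) (l := i + 1) (fun m _ => rfl), mul_one]
        · exact congrArg _ (by omega)
        · have := Nat.le_mul_of_pos_left (i + 1) (Nat.two_pow_pos k)
          omega
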